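/- Let $D$ be a weakly connected digraph, finite or infinite; parallel edges (and loops) are allowed. A *dicut* of $D$ is a set $B$ of edges for which there is a partition of $V(D)$ into two non-empty sides such that $B$ is the set of all edges between the sides and every edge of $B$ has its head in the same side, the *in-shore* of $B$; the other side is the *out-shore* (since $D$ is weakly connected, $B \ne \emptyset$ and the shores are determined by $B$). A *source component* (*sink component*) of $D$ is a strongly connected component that no edge enters (leaves). An *out-ray* (*back-ray*) is a one-way infinite path all of whose edges are directed away from (towards) its start vertex. A dicut is *sink-sided* if its out-shore contains neither a sink component nor an out-ray of $D$, *source-sided* if its in-shore contains neither a source component nor a back-ray of $D$, and a *source-sink dicut* if it is sink-sided or source-sided. The digraph $D$ is *source-sink connected* if for every $C^+$ that is a source component or a back-ray of $D$ and every $C^-$ that is a sink component or an out-ray of $D$ there is a directed (possibly trivial) path from $C^+$ to $C^-$ in $D$. Let $\mathfrak{B}$ be a non-empty class of dicuts of $D$. A *$\mathfrak{B}$-dijoin* is a set of edges meeting every member of $\mathfrak{B}$. We say that $D$ is *$\mathfrak{B}$-woodall* if the size of a smallest member of $\mathfrak{B}$ equals the size of a largest set of pairwise disjoint $\mathfrak{B}$-dijoins.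 A *capacity* $c$ assigns a cardinal $c(e)$ to every edge $e$, and $c(A) = \sum_{e \in A} c(e)$ (a cardinal sum) for a set $A$ of edges. We say that $D$ is *$\mathfrak{B}$-woodall with respect to $c$* if the least capacity $c(B)$ of a $B \in \mathfrak{B}$ equals the largest size of a family (repetitions allowed) of $\mathfrak{B}$-dijoins in which every edge $e$ lies in at most $c(e)$ members. In both cases the maximum is claimed to be attained. Then the following statements hold for every class below that is non-empty. 1. $D$ is $\mathfrak{B}$-woodall for the class $\mathfrak{B}$ of all source-sink dicuts of $D$ of finite size; and for every capacity $c$ of $D$, it is $\mathfrak{B}$-woodall with respect to $c$ for the class $\mathfrak{B}$ of all source-sink dicuts $B$ of $D$ of finite capacity $c(B)$. 2. If $D$ is source-sink connected, then $D$ is $\mathfrak{B}$-woodall for the class $\mathfrak{B}$ of all dicuts of $D$ of finite size; and for every capacity $c$ of $D$, it is $\mathfrak{B}$-woodall with respect to $c$ for the class $\mathfrak{B}$ of all dicuts $B$ of $D$ of finite capacity $c(B)$. -/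

import Mathlib

universe u v w

/-- A digraph with vertex set `V` and edge set `E`, of any size, in which parallel edges (and loops)
are allowed. Every edge points from its tail to its head. -/
structure MultiDigraph (V : Type u) (E : Type v) where
  tail : E → V
  head : E → V

namespace MultiDigraph

variable {V : Type u} {E : Type v}

/-- There is an edge from `x` to `y`. -/
def Adj (D : MultiDigraph V E) (x y : V) : Prop :=
  ∃ e, D.tail e = x ∧ D.head e = y

/-- There is a directed path (possibly trivial) from `x` to `y`. -/
def Reachable (D : MultiDigraph V E) (x y : V) : Prop :=
  Relation.ReflTransGen D.Adj x y

/-- The underlying undirected graph is connected (loops and multiplicities play no role in this). -/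
def WeaklyConnected (D : MultiDigraph V E) : Prop :=
  (SimpleGraph.fromRel D.Adj).Connected

/-- The edges with one end in `X \ Y` and the other end in `Y \ X`. -/
def edgesBetween (D : MultiDigraph V E) (X Y : Set V) : Set E :=
  {e | (D.head e ∈ X \ Y ∧ D.tail e ∈ Y \ X) ∨ (D.head e ∈ Y \ X ∧ D.tail e ∈ X \ Y)}

/-- `B` is the cut given by the non-trivial bipartition `(X, Xᶜ)` and all edges of `B` have their
head in `Xᶜ`: so `B` is a dicut with out-shore `X` and in-shore `Xᶜ`. If the digraph is weakly
connected, then `X` is determined by `B`. -/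
def IsOutShore (D : MultiDigraph V E) (X : Set V) (B : Set E) : Prop :=
  X.Nonempty ∧ Xᶜ.Nonempty ∧ B = D.edgesBetween X Xᶜ ∧ ∀ e ∈ B, D.head e ∈ Xᶜ

/-- A dicut: a cut all of whose edges have their head in one common side. -/
def IsDicut (D : MultiDigraph V E) (B : Set E) : Prop :=
  ∃ X : Set V, D.IsOutShore X B

/-- The vertex set of a strongly connected component. -/
def IsStrongComponent (D : MultiDigraph V E) (C : Set V) : Prop :=
  ∃ x, C = {y | D.Reachable x y ∧ D.Reachable y x}

/-- A strongly connected component that no edge enters. -/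
def IsSourceComponent (D : MultiDigraph V E) (C : Set V) : Prop :=
  D.IsStrongComponent C ∧ ∀ e, D.head e ∈ C → D.tail e ∈ C

/-- A strongly connected component that no edge leaves. -/
def IsSinkComponent (D : MultiDigraph V E) (C : Set V) : Prop :=
  D.IsStrongComponent C ∧ ∀ e, D.tail e ∈ C → D.head e ∈ C

/-- `R` is the vertex set of an out-ray: a one-way infinite path all of whose edges are directed away
from its start vertex. -/
def IsOutRay (D : MultiDigraph V E) (R : Set V) : Prop :=
  ∃ r : ℕ → V, Function.Injective r ∧ (∀ n, D.Adj (r n) (r (n + 1))) ∧ R = Set.range r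

/-- `R` is the vertex set of a back-ray: a one-way infinite path all of whose edges are directed
towards its start vertex. -/
def IsBackRay (D : MultiDigraph V E) (R : Set V) : Prop :=
  ∃ r : ℕ → V, Function.Injective r ∧ (∀ n, D.Adj (r (n + 1)) (r n)) ∧ R = Set.range r

/-- A dicut whose out-shore contains neither a sink component nor an out-ray. -/
def IsSinkSided (D : MultiDigraph V E) (B : Set E) : Prop :=
  ∃ X : Set V, D.IsOutShore X B ∧ ∀ C, D.IsSinkComponent C ∨ D.IsOutRay C → ¬ C ⊆ X

/-- A dicut whose in-shore contains neither a source component nor a back-ray. -/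
def IsSourceSided (D : MultiDigraph V E) (B : Set E) : Prop :=
  ∃ X : Set V, D.IsOutShore X B ∧ ∀ C, D.IsSourceComponent C ∨ D.IsBackRay C → ¬ C ⊆ Xᶜ

/-- A source-sink dicut. -/
def IsSourceSinkDicut (D : MultiDigraph V E) (B : Set E) : Prop :=
  D.IsDicut B ∧ (D.IsSourceSided B ∨ D.IsSinkSided B)

/-- From every source component or back-ray there is a directed path to every sink component or
out-ray. -/
def SourceSinkConnected (D : MultiDigraph V E) : Prop :=
  ∀ C₁ C₂ : Set V, D.IsSourceComponent C₁ ∨ D.IsBackRay C₁ →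
    D.IsSinkComponent C₂ ∨ D.IsOutRay C₂ → ∃ x ∈ C₁, ∃ y ∈ C₂, D.Reachable x y

end MultiDigraph

section Woodall

variable {E : Type v}

/-- The capacity of a set of edges, as a cardinal sum. -/
noncomputable def edgeCapacity (c : E → Cardinal.{w}) (A : Set E) : Cardinal.{max v w} :=
  Cardinal.sum fun a : A => c a

/-- A set of edges meeting every member of the class `𝔅`. -/
def IsDijoin (𝔅 : Set (Set E)) (F : Set E) : Prop :=
  ∀ B ∈ 𝔅, (F ∩ B).Nonempty

/-- A family of sets of edges, possibly with repetitions, in which each edge `e` lies in at most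
`c e` members. -/
def CapacityDisjoint (c : E → Cardinal.{w}) {ι : Type (max v w)} (F : ι → Set E) : Prop :=
  ∀ e, Cardinal.mk {i // e ∈ F i} ≤ Cardinal.lift.{v, w} (c e)

/-- The size of a smallest member of `𝔅` equals the size of a largest set of disjoint dijoins
for `𝔅`; both are attained. -/
def IsWoodall (𝔅 : Set (Set E)) : Prop :=
  ∃ κ : Cardinal.{v},
    IsLeast {μ | ∃ B ∈ 𝔅, Cardinal.mk B = μ} κ ∧
    IsGreatest {μ | ∃ 𝓕 : Set (Set E), (∀ F ∈ 𝓕, IsDijoin 𝔅 F) ∧ 𝓕.PairwiseDisjoint id ∧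
      Cardinal.mk 𝓕 = μ} κ

/-- The capacity of a cheapest member of `𝔅` equals the size of a largest family of `c`-disjoint
dijoins for `𝔅`; both are attained. -/
def IsWoodallWith (c : E → Cardinal.{w}) (𝔅 : Set (Set E)) : Prop :=
  ∃ κ : Cardinal.{max v w},
    IsLeast {μ | ∃ B ∈ 𝔅, edgeCapacity c B = μ} κ ∧
    IsGreatest {μ | ∃ (ι : Type (max v w)) (F : ι → Set E), (∀ i, IsDijoin 𝔅 (F i)) ∧
      CapacityDisjoint c F ∧ Cardinal.mk ι = μ} κ

end Woodall

/-! Disjoint dijoins meet any one dicut in distinct edges, so only the other direction needs work: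
with `k` the least size of a dicut in the class, the edges must be coloured so that each of `k`
colours appears on every dicut of the class. The colour classes are then the dijoins.

Let `𝒜` consist of out-shores of sink-sided dicuts and `ℬ` of in-shores of source-sided ones. Both
are closed under unions and non-empty intersections. If `X ∈ 𝒜` and `Y ∈ ℬ`, then `X \ Y` and `Y \
X` are again such shores: `X` contains a source component or a back-ray, and `Y` contains none, so
`X \ Y` is non-empty; dually for `Y \ X` (`sinkFamily_diff`).

For finite families, `IsPackingInstance.packable` inducts on the number of shores plus the number of
edges. A tight shore (left by exactly `k` edges) that is not minimal splits the instance in two, and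
the colourings are glued along its dicut, where each colour occurs once (`IsPackingInstance.glue`).
Edges in no tight dicut are deleted, and suitable pairs of edges are spliced into one. If nothing
applies, every edge has its tail in a minimal member of `𝒜` or its head in a minimal member of `ℬ`,
and the problem becomes one of packing bibranchings (`exists_bibranching_colouring`). The edges
doing both are coloured for both sides at once by Schrijver's supermodular colouring theorem
(`exists_supermodular_colouring`); the other edges then extend this colouring on each side
separately by a theorem on disjoint branchings with given roots (`exists_branching_colouring`).

Infinite digraphs follow by compactness (`IsCapacityModel.exists_colouring`), capacities by
replacing edges with copies. In a source-sink connected digraph every dicut is a source-sink dicut,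
which gives the second statement. -/

namespace DijoinPacking

/-! ### Disjoint branchings with prescribed roots -/

section Extend

open Finset
open scoped Classical

variable {V E : Type*}

/-- The edges of a finite set that have their tail in `X` and their head outside `X`. -/
noncomputable def leaving (A : Finset E) (t h : E → V) (X : Set V) : Finset E :=
  A.filter fun e => t e ∈ X ∧ h e ∉ X

theorem mem_leaving {A : Finset E} {t h : E → V} {X : Set V} {e : E} :
    e ∈ leaving A t h X ↔ e ∈ A ∧ t e ∈ X ∧ h e ∉ X := by
  simp [leaving]

/-- A family of non-empty sets closed under unions and non-empty intersections. -/
structure IsIntersecting (𝒜 : Set (Set V)) : Prop where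
  nonempty : ∀ X ∈ 𝒜, X.Nonempty
  union : ∀ X ∈ 𝒜, ∀ Y ∈ 𝒜, X ∪ Y ∈ 𝒜
  inter : ∀ X ∈ 𝒜, ∀ Y ∈ 𝒜, (X ∩ Y).Nonempty → X ∩ Y ∈ 𝒜

theorem IsIntersecting.sUnion_mem {𝒜 : Set (Set V)} (h𝒜 : IsIntersecting 𝒜) {𝒰 : Set (Set V)}
    (hfin : 𝒰.Finite) (hsub : 𝒰 ⊆ 𝒜) (hne : 𝒰.Nonempty) : ⋃₀ 𝒰 ∈ 𝒜 := by
  induction 𝒰, hfin using Set.Finite.induction_on with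
  | empty => simp at hne
  | @insert X 𝒰 _ _ ih =>
    rw [Set.sUnion_insert]
    rcases 𝒰.eq_empty_or_nonempty with rfl | hne'
    · simpa using hsub (Set.mem_insert X ∅)
    · exact h𝒜.union _ (hsub (Set.mem_insert _ _)) _
        (ih (fun Y hY => hsub (Set.mem_insert_of_mem _ hY)) hne')

theorem IsIntersecting.sInter_mem {𝒜 : Set (Set V)} (h𝒜 : IsIntersecting 𝒜) {𝒰 : Set (Set V)}
    (hfin : 𝒰.Finite) (hsub : 𝒰 ⊆ 𝒜) (hne : 𝒰.Nonempty) {v : V} (hv : ∀ X ∈ 𝒰, v ∈ X) :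
    ⋂₀ 𝒰 ∈ 𝒜 := by
  induction 𝒰, hfin using Set.Finite.induction_on with
  | empty => simp at hne
  | @insert X 𝒰 _ _ ih =>
    rw [Set.sInter_insert]
    rcases 𝒰.eq_empty_or_nonempty with rfl | hne'
    · simpa using hsub (Set.mem_insert X ∅)
    · exact h𝒜.inter _ (hsub (Set.mem_insert _ _)) _
        (ih (fun Y hY => hsub (Set.mem_insert_of_mem _ hY)) hne'
          fun Y hY => hv Y (Set.mem_insert_of_mem _ hY))
        ⟨v, hv X (Set.mem_insert _ _), fun Y hY => hv Y (Set.mem_insert_of_mem _ hY)⟩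

theorem card_leaving_submodular (A : Finset E) (t h : E → V) (X Y : Set V) :
    (leaving A t h (X ∩ Y)).card + (leaving A t h (X ∪ Y)).card ≤
      (leaving A t h X).card + (leaving A t h Y).card := by
  simp only [leaving, card_filter, ← sum_add_distrib]
  refine sum_le_sum fun e _ => ?_
  by_cases h1 : t e ∈ X <;> by_cases h2 : t e ∈ Y <;> by_cases h3 : h e ∈ X <;>
    by_cases h4 : h e ∈ Y <;> simp [h1, h2, h3, h4]

/-- The colours among the first `k` whose root set misses `X`. -/
noncomputable def missing (k : ℕ) (R : ℕ → Set V) (X : Set V) : Finset ℕ :=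
  (range k).filter fun i => ¬ (X ∩ R i).Nonempty

theorem mem_missing {k : ℕ} {R : ℕ → Set V} {X : Set V} {i : ℕ} :
    i ∈ missing k R X ↔ i < k ∧ ¬ (X ∩ R i).Nonempty := by
  simp [missing]

theorem missing_anti {k : ℕ} {R : ℕ → Set V} {X Y : Set V} (h : X ⊆ Y) :
    missing k R Y ⊆ missing k R X := by
  intro i hi
  rw [mem_missing] at hi ⊢
  exact ⟨hi.1, fun h' => hi.2 (h'.mono (Set.inter_subset_inter_left _ h))⟩

theorem card_missing_supermodular (k : ℕ) (R : ℕ → Set V) (X Y : Set V) :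
    (missing k R X).card + (missing k R Y).card ≤
      (missing k R (X ∩ Y)).card + (missing k R (X ∪ Y)).card := by
  rw [← card_union_add_card_inter (missing k R X)]
  refine add_le_add (card_le_card (union_subset (missing_anti Set.inter_subset_left)
    (missing_anti Set.inter_subset_right))) (card_le_card fun i hi => ?_)
  rw [mem_inter, mem_missing, mem_missing] at hi
  rw [mem_missing, Set.union_inter_distrib_right, Set.union_nonempty]
  exact ⟨hi.1.1, fun h => h.elim hi.1.2 hi.2.2⟩

theorem card_missing_supermodular_lt {k : ℕ} {R : ℕ → Set V} {X Y : Set V} {i : ℕ} (hi : i < k)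
    (hX : (X ∩ R i).Nonempty) (hY : (Y ∩ R i).Nonempty) (hXY : ¬ (X ∩ Y ∩ R i).Nonempty) :
    (missing k R X).card + (missing k R Y).card <
      (missing k R (X ∩ Y)).card + (missing k R (X ∪ Y)).card := by
  rw [← card_union_add_card_inter (missing k R X)]
  refine add_lt_add_of_lt_of_le (card_lt_card ⟨union_subset (missing_anti Set.inter_subset_left)
    (missing_anti Set.inter_subset_right), fun h => ?_⟩) (card_le_card fun i hi => ?_)
  · have := h (mem_missing.2 ⟨hi, hXY⟩)
    rw [mem_union, mem_missing, mem_missing] at this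
    tauto
  · rw [mem_inter, mem_missing, mem_missing] at hi
    rw [mem_missing, Set.union_inter_distrib_right, Set.union_nonempty]
    exact ⟨hi.1.1, fun h => h.elim hi.1.2 hi.2.2⟩

/-- One step of the construction of disjoint branchings: some edge can be given to colour `i`. -/
theorem exists_extending_edge {𝒜 : Set (Set V)} (hfin : 𝒜.Finite) (h𝒜 : IsIntersecting 𝒜)
    (t h : E → V) (k : ℕ) (b : Finset E) (R : ℕ → Set V)
    (hR : ∀ X ∈ 𝒜, (missing k R X).card ≤ (leaving b t h X).card)
    {i : ℕ} (hi : i < k) {X₀ : Set V} (hX₀ : X₀ ∈ 𝒜) (hX₀R : ¬ (X₀ ∩ R i).Nonempty) :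
    ∃ e ∈ b, (∀ X ∈ 𝒜, h e ∈ X → (X ∩ R i).Nonempty) ∧
      ∀ X ∈ 𝒜, t e ∈ X → h e ∉ X → (X ∩ R i).Nonempty →
        (missing k R X).card < (leaving b t h X).card := by
  set 𝒰 : Set (Set V) := {X ∈ 𝒜 | ¬ (X ∩ R i).Nonempty} with h𝒰
  -- `U` is the largest member without a root of colour `i`. A vertex outside `U` lies only in
  -- members that have such a root, so any edge leaving `U` satisfies the first claim.
  set U := ⋃₀ 𝒰 with hU
  have hUmem : U ∈ 𝒜 :=
    h𝒜.sUnion_mem (hfin.subset fun X hX => hX.1) (fun X hX => hX.1) ⟨X₀, hX₀, hX₀R⟩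
  have hUR : ¬ (U ∩ R i).Nonempty := by
    rintro ⟨v, ⟨X, hX, hvX⟩, hvR⟩
    exact hX.2 ⟨v, hvX, hvR⟩
  have hout : ∀ w, w ∉ U → ∀ X ∈ 𝒜, w ∈ X → (X ∩ R i).Nonempty := by
    intro w hw X hX hwX
    by_contra hne
    exact hw ⟨X, ⟨hX, hne⟩, hwX⟩
  -- The tight members that could obstruct an edge leaving `U`: they would lose an edge to colour
  -- `i`, which they do not miss.
  set 𝒦 : Set (Set V) := {K ∈ 𝒜 | (missing k R K).card = (leaving b t h K).card ∧
    (K ∩ R i).Nonempty ∧ (K ∩ U).Nonempty} with h𝒦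
  rcases 𝒦.eq_empty_or_nonempty with hemp | hne
  · have h1 : 0 < (leaving b t h U).card :=
      lt_of_lt_of_le (card_pos.2 ⟨i, mem_missing.2 ⟨hi, hUR⟩⟩) (hR U hUmem)
    obtain ⟨e, he⟩ := card_pos.1 h1
    rw [mem_leaving] at he
    refine ⟨e, he.1, hout _ he.2.2, fun X hX htX _ hXR => lt_of_le_of_ne (hR X hX) fun heq => ?_⟩
    have : X ∈ 𝒦 := ⟨hX, heq, hXR, ⟨t e, htX, he.2.1⟩⟩
    simp [hemp] at this
  · obtain ⟨K, hK⟩ := (hfin.subset (fun X hX => hX.1 : 𝒦 ⊆ 𝒜)).exists_minimal hne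
    obtain ⟨⟨hK𝒜, hKeq, hKR, hKU⟩, hKmin⟩ := hK
    have hKU𝒜 : K ∩ U ∈ 𝒜 := h𝒜.inter _ hK𝒜 _ hUmem hKU
    -- Colour `i` is missing from `K ∩ U` but not from `K`. As `K` is tight, more edges leave `K ∩
    -- U` than `K`; hence some edge runs from `K ∩ U` to `K \ U`.
    have hlt : (missing k R K).card < (missing k R (K ∩ U)).card := by
      refine card_lt_card ⟨missing_anti Set.inter_subset_left, fun h' => ?_⟩
      have : i ∈ missing k R (K ∩ U) :=
        mem_missing.2 ⟨hi, fun hn => hUR (hn.mono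
          (Set.inter_subset_inter_left _ Set.inter_subset_right))⟩
      exact (mem_missing.1 (h' this)).2 hKR
    have hlt2 : (leaving b t h K).card < (leaving b t h (K ∩ U)).card :=
      hKeq ▸ lt_of_lt_of_le hlt (hR _ hKU𝒜)
    obtain ⟨e, he, heK⟩ := exists_mem_notMem_of_card_lt_card hlt2
    rw [mem_leaving] at he heK
    have hhK : h e ∈ K := by
      by_contra hcon
      exact heK ⟨he.1, he.2.1.1, hcon⟩
    have hhU : h e ∉ U := fun hcon => he.2.2 ⟨hhK, hcon⟩
    refine ⟨e, he.1, hout _ hhU, fun X hX htX hhX hXR => lt_of_le_of_ne (hR X hX) fun heq => ?_⟩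
    have hKX : K ∩ X ∈ 𝒜 := h𝒜.inter _ hK𝒜 _ hX ⟨t e, he.2.1.1, htX⟩
    have hKX' : K ∪ X ∈ 𝒜 := h𝒜.union _ hK𝒜 _ hX
    have hsub := card_leaving_submodular b t h K X
    have h1 := hR _ hKX
    have h2 := hR _ hKX'
    -- Uncrossing the tight sets `K` and `X` makes `K ∩ X` tight. If it has a root of colour `i`,
    -- this contradicts the minimality of `K`, as the head of `e` is in `K` but not in `X`.
    -- Otherwise supermodularity is strict, which is impossible.
    by_cases hcase : (K ∩ X ∩ R i).Nonempty
    · have hsup := card_missing_supermodular k R K X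
      have : K ∩ X ∈ 𝒦 := ⟨hKX, by omega, hcase, ⟨t e, ⟨he.2.1.1, htX⟩, he.2.1.2⟩⟩
      exact hhX (hKmin this Set.inter_subset_left hhK).2
    · have hsup := card_missing_supermodular_lt hi hKR hXR hcase
      omega

/-- Disjoint branchings with prescribed root sets: if every member of an intersecting family is left
by as many edges as there are colours whose root set misses it, then the edges can be coloured so
that every colour either has a root in, or an edge leaving, each member. -/
theorem exists_branching_colouring {𝒜 : Set (Set V)} (hfin : 𝒜.Finite) (h𝒜 : IsIntersecting 𝒜)
    (t h : E → V) (k : ℕ) (b : Finset E) (R : ℕ → Set V)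
    (hR : ∀ X ∈ 𝒜, (missing k R X).card ≤ (leaving b t h X).card) :
    ∃ c : E → ℕ, ∀ X ∈ 𝒜, ∀ i < k, (X ∩ R i).Nonempty ∨ ∃ e ∈ leaving b t h X, c e = i := by
  induction b using Finset.strongInduction generalizing R with
  | H b ih =>
    by_cases hall : ∀ X ∈ 𝒜, ∀ i < k, (X ∩ R i).Nonempty
    · exact ⟨fun _ => 0, fun X hX i hi => Or.inl (hall X hX i hi)⟩
    · push Not at hall
      obtain ⟨X₀, hX₀, i, hi, hX₀R⟩ := hall
      obtain ⟨e, he, he1, he2⟩ := exists_extending_edge hfin h𝒜 t h k b R hR hi hX₀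
        (by rw [hX₀R]; exact Set.not_nonempty_empty)
      -- Colour `i` grows backwards along `e`: the tail of `e` becomes a root. A member containing
      -- this new root is left by `e` or contains the head of `e`, and in the latter case it already
      -- had a root.
      set R' : ℕ → Set V := Function.update R i (insert (t e) (R i)) with hR'
      have hR'i : R' i = insert (t e) (R i) := by simp [hR']
      have hR'j : ∀ j, j ≠ i → R' j = R j := fun j hj => by simp [hR', hj]
      have hmono : ∀ X, missing k R' X ⊆ missing k R X := by
        intro X j hj
        rw [mem_missing] at hj ⊢
        refine ⟨hj.1, fun hne => hj.2 (hne.mono (Set.inter_subset_inter_right _ ?_))⟩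
        by_cases hji : j = i
        · subst hji; rw [hR'i]; exact Set.subset_insert _ _
        · rw [hR'j j hji]
      have hcond : ∀ X ∈ 𝒜, (missing k R' X).card ≤ (leaving (b.erase e) t h X).card := by
        intro X hX
        have hX1 := hR X hX
        have hle := card_le_card (hmono X)
        have herase : leaving (b.erase e) t h X = (leaving b t h X).erase e := by
          ext f; simp only [mem_leaving, mem_erase]; tauto
        rw [herase]
        by_cases hleave : e ∈ leaving b t h X
        · rw [card_erase_of_mem hleave]
          rw [mem_leaving] at hleave
          by_cases hXR : (X ∩ R i).Nonempty
          · have := he2 X hX hleave.2.1 hleave.2.2 hXR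
            omega
          · have : (missing k R' X).card < (missing k R X).card := by
              refine card_lt_card ⟨hmono X, fun h' => ?_⟩
              have := (mem_missing.1 (h' (mem_missing.2 ⟨hi, hXR⟩))).2
              exact this ⟨t e, hleave.2.1, by rw [hR'i]; exact Set.mem_insert _ _⟩
            omega
        · rw [erase_eq_of_notMem hleave]
          omega
      obtain ⟨c, hc⟩ := ih (b.erase e) (erase_ssubset he) R' hcond
      refine ⟨Function.update c e i, fun X hX j hj => ?_⟩
      rcases hc X hX j hj with hc | ⟨f, hf, hfc⟩
      · by_cases hji : j = i
        · subst hji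
          rw [hR'i] at hc
          obtain ⟨v, hvX, hv⟩ := hc
          rcases hv with rfl | hv
          · by_cases hhX : h e ∈ X
            · exact Or.inl (he1 X hX hhX)
            · exact Or.inr ⟨e, mem_leaving.2 ⟨he, hvX, hhX⟩, by simp⟩
          · exact Or.inl ⟨v, hvX, hv⟩
        · rw [hR'j j hji] at hc
          exact Or.inl hc
      · rw [mem_leaving, mem_erase] at hf
        exact Or.inr ⟨f, mem_leaving.2 ⟨hf.1.2, hf.2⟩, by simp [hf.1.1, hfc]⟩

end Extend

/-! ### Uncrossing tight constraints of the fractional colour class polytope -/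

section Fractional

open Finset
open scoped Classical Topology

variable {V W E : Type*}

/-- The maximal non-empty members of `𝒯` inside `D` are disjoint, because the union of two members
that meet is a member. They therefore partition `D`, and each has an integral sum. -/
theorem exists_int_sum_of_covered {x : E → ℝ} {𝒯 : Set (Finset E)}
    (hclosed : ∀ T ∈ 𝒯, ∀ T' ∈ 𝒯, (T ∩ T').Nonempty → T ∩ T' ∈ 𝒯 ∧ T ∪ T' ∈ 𝒯)
    (hint : ∀ T ∈ 𝒯, ∃ n : ℤ, ∑ e ∈ T, x e = n) (D : Finset E)
    (hD : ∀ e ∈ D, ∃ T ∈ 𝒯, e ∈ T ∧ T ⊆ D) : ∃ n : ℤ, ∑ e ∈ D, x e = n := by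
  induction D using Finset.strongInduction with
  | H D ih =>
    rcases D.eq_empty_or_nonempty with rfl | ⟨e, he⟩
    · exact ⟨0, by simp⟩
    · obtain ⟨T₀, hT₀, heT₀, hT₀D⟩ := hD e he
      have hfin : {T ∈ 𝒯 | T ⊆ D ∧ T.Nonempty}.Finite :=
        (D.powerset.finite_toSet).subset fun T hT => by simpa using hT.2.1
      obtain ⟨T, ⟨hT, hTD, hTne⟩, hmax⟩ := hfin.exists_maximal ⟨T₀, hT₀, hT₀D, e, heT₀⟩
      obtain ⟨n, hn⟩ := ih (D \ T) (sdiff_ssubset hTD hTne) (by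
        intro f hf
        rw [mem_sdiff] at hf
        obtain ⟨T', hT', hfT', hT'D⟩ := hD f hf.1
        refine ⟨T', hT', hfT', fun g hg => mem_sdiff.2 ⟨hT'D hg, fun hgT => hf.2 ?_⟩⟩
        have := (hclosed T hT T' hT' ⟨g, mem_inter.2 ⟨hgT, hg⟩⟩).2
        exact hmax ⟨this, union_subset hTD hT'D, hTne.mono subset_union_left⟩
          subset_union_left (mem_union_right _ hfT'))
      obtain ⟨m, hm⟩ := hint T hT
      exact ⟨n + m, by rw [← sum_sdiff hTD, hn, hm]; push_cast; ring⟩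

/-- The class of `e` arises from the smallest member `Te` containing `e` by removing the members `T
∩ Te` with `e ∉ T`. The removed part is covered by members of `𝒯`, so its sum is integral too. -/
theorem exists_int_sum_class {Φ : Finset E} {x : E → ℝ} {𝒯 : Set (Finset E)} (hfin : 𝒯.Finite)
    (hsub : ∀ T ∈ 𝒯, T ⊆ Φ)
    (hclosed : ∀ T ∈ 𝒯, ∀ T' ∈ 𝒯, (T ∩ T').Nonempty → T ∩ T' ∈ 𝒯 ∧ T ∪ T' ∈ 𝒯)
    (hint : ∀ T ∈ 𝒯, ∃ n : ℤ, ∑ e ∈ T, x e = n) {e : E} (he : ∃ T ∈ 𝒯, e ∈ T) :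
    ∃ n : ℤ, ∑ f ∈ Φ with {T ∈ 𝒯 | f ∈ T} = {T ∈ 𝒯 | e ∈ T}, x f = n := by
  obtain ⟨T₀, hT₀, heT₀⟩ := he
  obtain ⟨Te, ⟨hTe, heTe⟩, hmin⟩ :=
    (hfin.subset (fun T hT => hT.1 : {T ∈ 𝒯 | e ∈ T} ⊆ 𝒯)).exists_minimal ⟨T₀, hT₀, heT₀⟩
  have hTele : ∀ T ∈ 𝒯, e ∈ T → Te ⊆ T := fun T hT heT f hf =>
    (mem_inter.1 (hmin (y := T ∩ Te) ⟨(hclosed T hT Te hTe ⟨e, mem_inter.2 ⟨heT, heTe⟩⟩).1,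
      mem_inter.2 ⟨heT, heTe⟩⟩ inter_subset_right hf)).1
  set C := Φ.filter fun f => {T ∈ 𝒯 | f ∈ T} = {T ∈ 𝒯 | e ∈ T} with hC
  have hiff : ∀ f ∈ C, ∀ T ∈ 𝒯, f ∈ T ↔ e ∈ T := by
    intro f hf T hT
    have := Set.ext_iff.1 (mem_filter.1 hf).2 T
    simpa [hT] using this
  have hCsub : C ⊆ Te := fun f hf => (hiff f hf Te hTe).2 heTe
  obtain ⟨m, hm⟩ := hint Te hTe
  obtain ⟨n, hn⟩ := exists_int_sum_of_covered hclosed hint (Te \ C) (by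
    intro f hf
    rw [mem_sdiff] at hf
    obtain ⟨T, hT, hfT, heT⟩ : ∃ T ∈ 𝒯, f ∈ T ∧ e ∉ T := by
      by_contra! hcon
      refine hf.2 (mem_filter.2 ⟨hsub Te hTe hf.1, Set.ext fun T => ?_⟩)
      exact ⟨fun hT => ⟨hT.1, hcon T hT.1 hT.2⟩, fun hT => ⟨hT.1, hTele T hT.1 hT.2 hf.1⟩⟩
    refine ⟨T ∩ Te, (hclosed T hT Te hTe ⟨f, mem_inter.2 ⟨hfT, hf.1⟩⟩).1,
      mem_inter.2 ⟨hfT, hf.1⟩, fun g hg => mem_sdiff.2 ⟨(mem_inter.1 hg).2, fun hgC => ?_⟩⟩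
    exact heT ((hiff g hgC T hT).1 (mem_inter.1 hg).1))
  refine ⟨m - n, ?_⟩
  rw [← sum_sdiff hCsub, hn] at hm
  push_cast
  linarith

/-- Two partial partitions of a finite set into classes of size at least two admit a common
non-zero weighting of total weight zero on every class. -/
theorem exists_weighting {α β : Type*} {Φ : Finset E} (hΦ : Φ.Nonempty) (σ : E → α) (τ : E → β)
    (S : Finset α) (T : Finset β) (hS : ∀ s ∈ S, 2 ≤ (Φ.filter fun e => σ e = s).card)
    (hT : ∀ s ∈ T, 2 ≤ (Φ.filter fun e => τ e = s).card) :
    ∃ w : E → ℝ, w ≠ 0 ∧ (∀ e ∉ Φ, w e = 0) ∧ (∀ s ∈ S, ∑ e ∈ Φ with σ e = s, w e = 0) ∧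
      ∀ s ∈ T, ∑ e ∈ Φ with τ e = s, w e = 0 := by
  let A : Matrix (S ⊕ T) Φ ℝ := fun i e =>
    Sum.elim (fun s : S => if σ e = s then 1 else 0) (fun s : T => if τ e = s then 1 else 0) i
  have hAl : ∀ (g : Φ → ℝ) (s : S), A.mulVec g (Sum.inl s) = ∑ e : Φ, if σ e = s then g e else 0 := by
    intro g s
    simp [Matrix.mulVec, dotProduct, A]
  have hAr : ∀ (g : Φ → ℝ) (s : T), A.mulVec g (Sum.inr s) = ∑ e : Φ, if τ e = s then g e else 0 := by
    intro g s
    simp [Matrix.mulVec, dotProduct, A]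
  have hcardS : S.card * 2 ≤ (Φ.filter fun e => σ e ∈ S).card := by
    rw [card_eq_sum_card_fiberwise (f := σ) (t := S) (fun e he => by simpa using (mem_filter.1 he).2)]
    refine card_nsmul_le_sum _ _ _ fun s hs => (hS s hs).trans (card_le_card fun e he => ?_)
    rw [mem_filter] at he
    simp [he.1, he.2, hs]
  have hcardT : T.card * 2 ≤ (Φ.filter fun e => τ e ∈ T).card := by
    rw [card_eq_sum_card_fiberwise (f := τ) (t := T) (fun e he => by simpa using (mem_filter.1 he).2)]
    refine card_nsmul_le_sum _ _ _ fun s hs => (hT s hs).trans (card_le_card fun e he => ?_)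
    rw [mem_filter] at he
    simp [he.1, he.2, hs]
  have hSle := card_filter_le Φ fun e => σ e ∈ S
  have hTle := card_filter_le Φ fun e => τ e ∈ T
  -- Classes have size at least two, so there are at most as many equations as unknowns. In case of
  -- equality both `S` and `T` cover all of `Φ`; then the rows of `S` and the rows of `T` have the
  -- same sum, and the system is still singular.
  have hninj : ¬ Function.Injective A.mulVecLin := by
    intro hinj
    have hle := LinearMap.finrank_le_finrank_of_injective hinj
    simp only [Module.finrank_fintype_fun_eq_card, Fintype.card_coe, Fintype.card_sum] at hle
    have hsurj : Function.Surjective A.mulVecLin := by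
      rw [← LinearMap.injective_iff_surjective_of_finrank_eq_finrank]
      · exact hinj
      · simp only [Module.finrank_fintype_fun_eq_card, Fintype.card_coe, Fintype.card_sum]
        omega
    have hpos := card_pos.2 hΦ
    have hSpos : 0 < S.card := by omega
    obtain ⟨s₀, hs₀⟩ := card_pos.1 hSpos
    have hSall : ∀ e ∈ Φ, σ e ∈ S := filter_eq_self.1
      (eq_of_subset_of_card_le (filter_subset (fun e => σ e ∈ S) Φ) (by omega))
    have hTall : ∀ e ∈ Φ, τ e ∈ T := filter_eq_self.1
      (eq_of_subset_of_card_le (filter_subset (fun e => τ e ∈ T) Φ) (by omega))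
    obtain ⟨g, hg⟩ := hsurj (Pi.single (Sum.inl ⟨s₀, hs₀⟩) 1)
    rw [Matrix.mulVecLin_apply] at hg
    have h1 : ∑ s : S, A.mulVec g (Sum.inl s) = ∑ e : Φ, g e := by
      simp only [hAl]
      rw [sum_comm]
      refine sum_congr rfl fun e _ => ?_
      rw [sum_eq_single ⟨σ e, hSall e e.2⟩]
      · simp
      · intro s _ hs
        rw [if_neg]
        intro hcon
        exact hs (Subtype.ext hcon.symm)
      · simp
    have h2 : ∑ s : T, A.mulVec g (Sum.inr s) = ∑ e : Φ, g e := by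
      simp only [hAr]
      rw [sum_comm]
      refine sum_congr rfl fun e _ => ?_
      rw [sum_eq_single ⟨τ e, hTall e e.2⟩]
      · simp
      · intro s _ hs
        rw [if_neg]
        intro hcon
        exact hs (Subtype.ext hcon.symm)
      · simp
    have h3 : ∑ s : S, A.mulVec g (Sum.inl s) = 1 := by
      simp [hg, Pi.single_apply]
    have h4 : ∑ s : T, A.mulVec g (Sum.inr s) = 0 := by
      simp [hg]
    linarith
  obtain ⟨g, hg0, hg⟩ : ∃ g, A.mulVecLin g = 0 ∧ g ≠ 0 := by
    by_contra! hcon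
    exact hninj ((injective_iff_map_eq_zero _).2 hcon)
  rw [Matrix.mulVecLin_apply] at hg0
  set w : E → ℝ := fun e => if he : e ∈ Φ then g ⟨e, he⟩ else 0 with hw
  have hwg : ∀ e : Φ, w e = g e := fun e => by simp [hw]
  refine ⟨w, fun h0 => hg (funext fun e => ?_), fun e he => by simp [hw, he], fun s hs => ?_,
    fun s hs => ?_⟩
  · rw [← hwg, h0]; rfl
  · have := congrFun hg0 (Sum.inl ⟨s, hs⟩)
    rw [hAl] at this
    rw [sum_filter, ← sum_coe_sort]
    simpa [hwg] using this
  · have := congrFun hg0 (Sum.inr ⟨s, hs⟩)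
    rw [hAr] at this
    rw [sum_filter, ← sum_coe_sort]
    simpa [hwg] using this

/-- The elements of a finite set that are mapped into `X`. -/
noncomputable def sect (M : Finset E) (t : E → V) (X : Set V) : Finset E :=
  M.filter fun e => t e ∈ X

theorem mem_sect {M : Finset E} {t : E → V} {X : Set V} {e : E} :
    e ∈ sect M t X ↔ e ∈ M ∧ t e ∈ X := by
  simp [sect]

theorem sum_sect_inter_add_sum_sect_union {R : Type*} [AddCommMonoid R] (M : Finset E) (t : E → V)
    (X Y : Set V) (f : E → R) :
    ∑ e ∈ sect M t (X ∩ Y), f e + ∑ e ∈ sect M t (X ∪ Y), f e =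
      ∑ e ∈ sect M t X, f e + ∑ e ∈ sect M t Y, f e := by
  simp only [sect, sum_filter, ← sum_add_distrib]
  refine sum_congr rfl fun e _ => ?_
  by_cases h1 : t e ∈ X <;> by_cases h2 : t e ∈ Y <;> simp [h1, h2]

theorem card_sect_inter_add_card_sect_union (M : Finset E) (t : E → V) (X Y : Set V) :
    (sect M t (X ∩ Y)).card + (sect M t (X ∪ Y)).card = (sect M t X).card + (sect M t Y).card := by
  simpa only [card_eq_sum_ones] using sum_sect_inter_add_sum_sect_union M t X Y fun _ => 1

/-- A requirement function that is supermodular on intersecting pairs and bounded both by the number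
`k` of colours and by the number of available elements. -/
structure IsRequirement (M : Finset E) (t : E → V) (𝒜 : Set (Set V)) (p : Set V → ℤ) (k : ℕ) :
    Prop where
  le_colours : ∀ X ∈ 𝒜, p X ≤ k
  le_card : ∀ X ∈ 𝒜, p X ≤ (sect M t X).card
  supermodular : ∀ X ∈ 𝒜, ∀ Y ∈ 𝒜, (X ∩ Y).Nonempty → p X + p Y ≤ p (X ∩ Y) + p (X ∪ Y)

/-- The linear relaxation of being a possible colour class. -/
def IsFractionalClass (M : Finset E) (t : E → V) (𝒜 : Set (Set V)) (p : Set V → ℤ) (k : ℕ)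
    (x : E → ℝ) : Prop :=
  ∀ X ∈ 𝒜, (p X = k → 1 ≤ ∑ e ∈ sect M t X, x e) ∧
    ∑ e ∈ sect M t X, x e ≤ (sect M t X).card - p X + 1

/-- Some constraint of `X` holds with equality. -/
def IsTight (M : Finset E) (t : E → V) (p : Set V → ℤ) (k : ℕ) (x : E → ℝ) (X : Set V) : Prop :=
  (p X = k ∧ ∑ e ∈ sect M t X, x e = 1) ∨ ∑ e ∈ sect M t X, x e = (sect M t X).card - p X + 1

/-- Along `w` the sums over tight sets do not change, and the finitely many remaining constraints
have slack. -/
theorem IsFractionalClass.eventually {M : Finset E} {t : E → V} {𝒜 : Set (Set V)} {p : Set V → ℤ}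
    {k : ℕ} {x w : E → ℝ} (hfin : 𝒜.Finite) (hx : IsFractionalClass M t 𝒜 p k x)
    (hw : ∀ X ∈ 𝒜, IsTight M t p k x X → ∑ e ∈ sect M t X, w e = 0) :
    ∀ᶠ ε in 𝓝 (0 : ℝ), IsFractionalClass M t 𝒜 p k (x + ε • w) := by
  refine (Filter.eventually_all_finite hfin).2 fun X hX => ?_
  have hsum : ∀ ε : ℝ, ∑ e ∈ sect M t X, (x + ε • w) e =
      ∑ e ∈ sect M t X, x e + ε * ∑ e ∈ sect M t X, w e := fun ε => by
    simp [sum_add_distrib, mul_sum]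
  simp only [hsum]
  have hcont : Filter.Tendsto (fun ε : ℝ => ∑ e ∈ sect M t X, x e + ε * ∑ e ∈ sect M t X, w e)
      (𝓝 0) (𝓝 (∑ e ∈ sect M t X, x e)) := by
    have : Continuous fun ε : ℝ => ∑ e ∈ sect M t X, x e + ε * ∑ e ∈ sect M t X, w e := by
      fun_prop
    simpa using this.tendsto 0
  by_cases htight : IsTight M t p k x X
  · rw [hw X hX htight]
    simpa using hx X hX
  · unfold IsTight at htight
    push Not at htight
    refine Filter.Eventually.and ?_ ?_
    · by_cases hp : p X = k
      · have := lt_of_le_of_ne ((hx X hX).1 hp) (htight.1 hp).symm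
        filter_upwards [hcont.eventually_const_lt this] with ε hε _ using hε.le
      · simp [hp]
    · have := lt_of_le_of_ne (hx X hX).2 htight.2
      filter_upwards [hcont.eventually_lt_const this] with ε hε using hε.le

/-- The elements on which a weighting is not integral. -/
noncomputable def fractional (M : Finset E) (x : E → ℝ) : Finset E :=
  M.filter fun e => 0 < x e ∧ x e < 1

theorem exists_int_sum_sect_fractional {M : Finset E} {t : E → V} {x : E → ℝ}
    (hx : ∀ e ∈ M, 0 ≤ x e ∧ x e ≤ 1) {X : Set V}
    (hX : ∃ n : ℤ, ∑ e ∈ sect M t X, x e = n) :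
    ∃ n : ℤ, ∑ e ∈ sect (fractional M x) t X, x e = n := by
  obtain ⟨n, hn⟩ := hX
  have hsub : sect (fractional M x) t X ⊆ sect M t X := by
    intro e he
    rw [mem_sect, fractional, mem_filter] at he
    exact mem_sect.2 ⟨he.1.1, he.2⟩
  obtain ⟨m, hm⟩ : ∃ m : ℤ, ∑ e ∈ sect M t X \ sect (fractional M x) t X, x e = m := by
    refine ⟨((sect M t X \ sect (fractional M x) t X).filter fun e => x e = 1).card, ?_⟩
    rw [card_filter]
    push_cast
    refine sum_congr rfl fun e he => ?_
    rw [mem_sdiff, mem_sect, mem_sect, fractional, mem_filter] at he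
    obtain ⟨h0, h1⟩ := hx e he.1.1
    split_ifs with h
    · exact h
    · by_contra hne
      exact he.2 ⟨⟨he.1.1, lt_of_le_of_ne h0 (Ne.symm hne), lt_of_le_of_ne h1 h⟩, he.1.2⟩
  refine ⟨n - m, ?_⟩
  rw [← sum_sdiff hsub, hm] at hn
  push_cast
  linarith

/-- The traces of the tight sets on the non-integral elements are closed under uncrossing. -/
theorem tight_uncross {M : Finset E} {t : E → V} {𝒜 : Set (Set V)} {p : Set V → ℤ} {k : ℕ}
    {x : E → ℝ} (h𝒜 : IsIntersecting 𝒜) (hp : IsRequirement M t 𝒜 p k)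
    (hx : ∀ e ∈ M, 0 ≤ x e ∧ x e ≤ 1) (hxA : IsFractionalClass M t 𝒜 p k x)
    {X Y : Set V} (hX : X ∈ 𝒜) (hY : Y ∈ 𝒜) (hXY : (X ∩ Y).Nonempty)
    (htX : IsTight M t p k x X) (htY : IsTight M t p k x Y) :
    (IsTight M t p k x (X ∩ Y) ∧ IsTight M t p k x (X ∪ Y)) ∨
      sect (fractional M x) t Y ⊆ sect (fractional M x) t X ∨
      sect (fractional M x) t X ⊆ sect (fractional M x) t Y := by
  -- From `p X = k` and `p (X ∪ Y) ≤ k` it follows that `p Y ≤ p (X ∩ Y)`. Subtracting the upper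
  -- bound at `X ∩ Y` from the equality at `Y` shows that `x` has value 1 throughout the part of `Y`
  -- outside `X`; all fractional elements of `Y` thus lie in `X`.
  have hmixed : ∀ X Y : Set V, X ∈ 𝒜 → Y ∈ 𝒜 → (X ∩ Y).Nonempty →
      p X = k → ∑ e ∈ sect M t Y, x e = (sect M t Y).card - p Y + 1 →
      sect (fractional M x) t Y ⊆ sect (fractional M x) t X := by
    intro X Y hX hY hXY hpX hxY e he
    rw [mem_sect] at he ⊢
    refine ⟨he.1, ?_⟩
    by_contra heX
    have hsub : sect M t (X ∩ Y) ⊆ sect M t Y := fun f hf => by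
      rw [mem_sect] at hf ⊢; exact ⟨hf.1, hf.2.2⟩
    have hmem : e ∈ sect M t Y \ sect M t (X ∩ Y) := by
      rw [mem_sdiff, mem_sect, mem_sect]
      exact ⟨⟨(mem_filter.1 he.1).1, he.2⟩, fun h => heX h.2.1⟩
    have hlt : ∑ f ∈ sect M t Y \ sect M t (X ∩ Y), x f <
        ∑ f ∈ sect M t Y \ sect M t (X ∩ Y), (1 : ℝ) :=
      sum_lt_sum (fun f hf => (hx f (mem_sect.1 (mem_sdiff.1 hf).1).1).2)
        ⟨e, hmem, (mem_filter.1 he.1).2.2⟩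
    have h1 := sum_sdiff hsub (f := x)
    have h2 := (hxA _ (h𝒜.inter X hX Y hY hXY)).2
    have h3 : (p X + p Y : ℝ) ≤ p (X ∩ Y) + p (X ∪ Y) := by
      exact_mod_cast hp.supermodular X hX Y hY hXY
    have h4 : (p (X ∪ Y) : ℝ) ≤ k := by exact_mod_cast hp.le_colours _ (h𝒜.union X hX Y hY)
    have h5 : ((sect M t Y \ sect M t (X ∩ Y)).card : ℝ) + (sect M t (X ∩ Y)).card =
        (sect M t Y).card := by
      exact_mod_cast card_sdiff_add_card_eq_card hsub
    have h6 : (p X : ℝ) = k := by exact_mod_cast hpX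
    rw [sum_const, nsmul_eq_mul, mul_one] at hlt
    linarith
  have hI := h𝒜.inter X hX Y hY hXY
  have hU := h𝒜.union X hX Y hY
  have hsum := sum_sect_inter_add_sum_sect_union M t X Y x
  have hsup := hp.supermodular X hX Y hY hXY
  rcases htX with ⟨hpX, hxX⟩ | hxX <;> rcases htY with ⟨hpY, hxY⟩ | hxY
  · left
    have h1 := hp.le_colours _ hI
    have h2 := hp.le_colours _ hU
    have hpI : p (X ∩ Y) = k := by omega
    have hpU : p (X ∪ Y) = k := by omega
    have h3 := (hxA _ hI).1 hpI
    have h4 := (hxA _ hU).1 hpU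
    exact ⟨Or.inl ⟨hpI, by linarith⟩, Or.inl ⟨hpU, by linarith⟩⟩
  · exact Or.inr (Or.inl (hmixed X Y hX hY hXY hpX hxY))
  · exact Or.inr (Or.inr (hmixed Y X hY hX (by rwa [Set.inter_comm]) hpY hxX))
  · left
    have h1 := (hxA _ hI).2
    have h2 := (hxA _ hU).2
    have h3 : (p X + p Y : ℝ) ≤ p (X ∩ Y) + p (X ∪ Y) := by exact_mod_cast hsup
    have h4 : ((sect M t (X ∩ Y)).card : ℝ) + (sect M t (X ∪ Y)).card =
        (sect M t X).card + (sect M t Y).card := by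
      exact_mod_cast card_sect_inter_add_card_sect_union M t X Y
    exact ⟨Or.inr (by linarith), Or.inr (by linarith)⟩

/-- The tight constraints of one side are governed by disjoint classes of at least two
non-integral elements each. -/
theorem exists_tight_classes {M : Finset E} {t : E → V} {𝒜 : Set (Set V)} {p : Set V → ℤ} {k : ℕ}
    {x : E → ℝ} (hfin : 𝒜.Finite) (h𝒜 : IsIntersecting 𝒜) (hp : IsRequirement M t 𝒜 p k)
    (hx : ∀ e ∈ M, 0 ≤ x e ∧ x e ≤ 1) (hxA : IsFractionalClass M t 𝒜 p k x) :
    ∃ (σ : E → Set (Finset E)) (S : Finset (Set (Finset E))),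
      (∀ s ∈ S, 2 ≤ ((fractional M x).filter fun e => σ e = s).card) ∧
      ∀ w : E → ℝ, (∀ e ∉ fractional M x, w e = 0) →
        (∀ s ∈ S, ∑ e ∈ fractional M x with σ e = s, w e = 0) →
        ∀ X ∈ 𝒜, IsTight M t p k x X → ∑ e ∈ sect M t X, w e = 0 := by
  set Φ := fractional M x with hΦ
  set 𝒯 : Set (Finset E) := {T | ∃ X ∈ 𝒜, IsTight M t p k x X ∧ sect Φ t X = T} with h𝒯
  have h𝒯fin : 𝒯.Finite := (hfin.image fun X => sect Φ t X).subset fun T hT =>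
    let ⟨X, hX, _, hXT⟩ := hT; ⟨X, hX, hXT⟩
  have hsub : ∀ T ∈ 𝒯, T ⊆ Φ := by
    rintro T ⟨X, _, _, rfl⟩
    exact filter_subset _ _
  have hclosed : ∀ T ∈ 𝒯, ∀ T' ∈ 𝒯, (T ∩ T').Nonempty → T ∩ T' ∈ 𝒯 ∧ T ∪ T' ∈ 𝒯 := by
    rintro T ⟨X, hX, htX, rfl⟩ T' ⟨Y, hY, htY, rfl⟩ ⟨e, he⟩
    rw [mem_inter, mem_sect, mem_sect] at he
    have hXY : (X ∩ Y).Nonempty := ⟨t e, he.1.2, he.2.2⟩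
    rcases tight_uncross h𝒜 hp hx hxA hX hY hXY htX htY with ⟨h1, h2⟩ | h | h
    · refine ⟨⟨X ∩ Y, h𝒜.inter X hX Y hY hXY, h1, ?_⟩, ⟨X ∪ Y, h𝒜.union X hX Y hY, h2, ?_⟩⟩
      · ext f; simp only [mem_inter, mem_sect, Set.mem_inter_iff]; tauto
      · ext f; simp only [mem_union, mem_sect, Set.mem_union]; tauto
    · rw [inter_eq_right.2 h, union_eq_left.2 h]
      exact ⟨⟨Y, hY, htY, rfl⟩, ⟨X, hX, htX, rfl⟩⟩
    · rw [inter_eq_left.2 h, union_eq_right.2 h]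
      exact ⟨⟨X, hX, htX, rfl⟩, ⟨Y, hY, htY, rfl⟩⟩
  have hint : ∀ T ∈ 𝒯, ∃ n : ℤ, ∑ e ∈ T, x e = n := by
    rintro T ⟨X, hX, htX, rfl⟩
    refine exists_int_sum_sect_fractional hx ?_
    rcases htX with ⟨_, h⟩ | h
    · exact ⟨1, by simpa using h⟩
    · exact ⟨(sect M t X).card - p X + 1, by rw [h]; push_cast; ring⟩
  refine ⟨fun e => {T ∈ 𝒯 | e ∈ T}, (Φ.image fun e => {T ∈ 𝒯 | e ∈ T}).filter
    fun s => s.Nonempty, fun s hs => ?_, fun w hw hws X hX htX => ?_⟩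
  · rw [mem_filter, mem_image] at hs
    obtain ⟨⟨e, he, rfl⟩, T, hT, heT⟩ := hs
    obtain ⟨n, hn⟩ := exists_int_sum_class h𝒯fin hsub hclosed hint ⟨T, hT, heT⟩
    -- A class with one element would have an integral value strictly between 0 and 1.
    by_contra hlt
    change ¬ 2 ≤ (Φ.filter fun f => {T ∈ 𝒯 | f ∈ T} = {T ∈ 𝒯 | e ∈ T}).card at hlt
    have hmem : e ∈ Φ.filter fun f => {T ∈ 𝒯 | f ∈ T} = {T ∈ 𝒯 | e ∈ T} := by
      simp [he]
    have hcard : (Φ.filter fun f => {T ∈ 𝒯 | f ∈ T} = {T ∈ 𝒯 | e ∈ T}).card = 1 :=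
      le_antisymm (by omega) (card_pos.2 ⟨e, hmem⟩)
    obtain ⟨f, hf⟩ := card_eq_one.1 hcard
    rw [hf, mem_singleton] at hmem
    rw [hf, sum_singleton, ← hmem] at hn
    have he' := (mem_filter.1 he).2
    rw [hn] at he'
    have h1 : (0 : ℤ) < n := by exact_mod_cast he'.1
    have h2 : n < (1 : ℤ) := by exact_mod_cast he'.2
    omega
  · have hT : sect Φ t X ∈ 𝒯 := ⟨X, hX, htX, rfl⟩
    have hsubM : sect Φ t X ⊆ sect M t X := by
      intro e he
      rw [mem_sect] at he ⊢
      exact ⟨(mem_filter.1 he.1).1, he.2⟩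
    rw [← sum_subset hsubM fun e heM he => hw e fun heΦ => he
      (mem_sect.2 ⟨heΦ, (mem_sect.1 heM).2⟩)]
    -- The trace of a tight set is a union of classes.
    rw [← sum_fiberwise_of_maps_to (t := (sect Φ t X).image fun e => {T ∈ 𝒯 | e ∈ T})
      (g := fun e => {T ∈ 𝒯 | e ∈ T}) fun e he => mem_image_of_mem _ he]
    refine sum_eq_zero fun s hs => ?_
    rw [mem_image] at hs
    obtain ⟨e, he, rfl⟩ := hs
    rw [← hws {T ∈ 𝒯 | e ∈ T} (mem_filter.2 ⟨mem_image_of_mem _ (hsub _ hT he), _, hT, he⟩)]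
    refine sum_congr (Finset.ext fun f => ?_) fun _ _ => rfl
    rw [mem_filter, mem_filter]
    refine ⟨fun hf => ⟨hsub _ hT hf.1, hf.2⟩, fun hf => ⟨?_, hf.2⟩⟩
    have := (Set.ext_iff.1 hf.2 (sect Φ t X)).2 ⟨hT, he⟩
    exact this.2

end Fractional

/-! ### Supermodular colouring and disjoint bibranchings -/

section SupermodularColouring

open Finset
open scoped Classical Topology

variable {V W E : Type*}

theorem isClosed_isFractionalClass (M : Finset E) (t : E → V) (𝒜 : Set (Set V)) (p : Set V → ℤ)
    (k : ℕ) : IsClosed {x : E → ℝ | IsFractionalClass M t 𝒜 p k x} := by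
  have : {x : E → ℝ | IsFractionalClass M t 𝒜 p k x} =
      ⋂ X ∈ 𝒜, ((⋂ _ : p X = k, {x : E → ℝ | 1 ≤ ∑ e ∈ sect M t X, x e}) ∩
        {x : E → ℝ | ∑ e ∈ sect M t X, x e ≤ (sect M t X).card - p X + 1}) := by
    ext x
    simp [IsFractionalClass]
  rw [this]
  refine isClosed_biInter fun X _ => (isClosed_iInter fun _ => ?_).inter ?_
  · exact isClosed_le (by fun_prop) (by fun_prop)
  · exact isClosed_le (by fun_prop) (by fun_prop)

/-- With `s` the size of the section at `X`, the upper bound is `0 ≤ (k - 1) * (s - p X) + (k - p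
X)` after multiplication by `k`. This point shows that the polytope is non-empty. -/
theorem isFractionalClass_const {M : Finset E} {t : E → V} {𝒜 : Set (Set V)} {p : Set V → ℤ}
    {k : ℕ} (hp : IsRequirement M t 𝒜 p k) (hk : 1 ≤ k) :
    IsFractionalClass M t 𝒜 p k fun e => if e ∈ M then (1 / k : ℝ) else 0 := by
  intro X hX
  have hsum : (∑ e ∈ sect M t X, if e ∈ M then (1 / k : ℝ) else 0) = (sect M t X).card * (1 / k) := by
    rw [sum_congr rfl fun e he => if_pos (mem_sect.1 he).1]
    simp
  have hk0 : (0 : ℝ) < k := by exact_mod_cast hk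
  have hk1 : (1 : ℝ) ≤ k := by exact_mod_cast hk
  have h1 : (p X : ℝ) ≤ k := by exact_mod_cast hp.le_colours X hX
  have h2 : (p X : ℝ) ≤ (sect M t X).card := by exact_mod_cast hp.le_card X hX
  rw [hsum]
  refine ⟨fun h => ?_, ?_⟩
  · have h3 : (p X : ℝ) = k := by exact_mod_cast h
    rw [mul_one_div, le_div_iff₀ hk0]
    linarith
  · rw [mul_one_div, div_le_iff₀ hk0]
    nlinarith [mul_le_mul_of_nonneg_right h2 (sub_nonneg.2 hk1)]

theorem sum_sect_eq_card {M : Finset E} {x : E → ℝ} (hx : ∀ e ∈ M, x e = if x e = 1 then 1 else 0)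
    (t : E → V) (X : Set V) :
    ∑ e ∈ sect M t X, x e = (sect (M.filter fun e => x e = 1) t X).card := by
  rw [sum_congr rfl fun e he => hx e (mem_sect.1 he).1, ← sum_filter, sum_const, nsmul_eq_mul,
    mul_one]
  congr 2
  ext e
  simp only [mem_filter, mem_sect]
  tauto

/-- A possible colour class: it meets every set that needs all colours, and leaves enough elements
for the other colours. -/
theorem exists_colour_class {M : Finset E} {t : E → V} {h : E → W} {𝒜 : Set (Set V)}
    {ℬ : Set (Set W)} {p : Set V → ℤ} {q : Set W → ℤ} {k : ℕ} (hk : 1 ≤ k)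
    (hfinA : 𝒜.Finite) (hfinB : ℬ.Finite) (h𝒜 : IsIntersecting 𝒜) (hℬ : IsIntersecting ℬ)
    (hp : IsRequirement M t 𝒜 p k) (hq : IsRequirement M h ℬ q k) :
    ∃ F ⊆ M,
      (∀ X ∈ 𝒜, (p X = k → (sect F t X).Nonempty) ∧
        ((sect F t X).card : ℤ) ≤ (sect M t X).card - p X + 1) ∧
      (∀ Y ∈ ℬ, (q Y = k → (sect F h Y).Nonempty) ∧
        ((sect F h Y).card : ℤ) ≤ (sect M h Y).card - q Y + 1) := by
  -- Coordinates outside `M` are fixed at 0, so `K` is compact even if `E` is infinite, and it has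
  -- an extreme point.
  set K : Set (E → ℝ) := (Set.univ.pi fun e => if e ∈ M then Set.Icc (0 : ℝ) 1 else {0}) ∩
    ({x | IsFractionalClass M t 𝒜 p k x} ∩ {x | IsFractionalClass M h ℬ q k x}) with hK
  have hmemK : ∀ x, x ∈ K ↔ (∀ e ∈ M, 0 ≤ x e ∧ x e ≤ 1) ∧ (∀ e ∉ M, x e = 0) ∧
      IsFractionalClass M t 𝒜 p k x ∧ IsFractionalClass M h ℬ q k x := by
    intro x
    have : (x ∈ Set.univ.pi fun e => if e ∈ M then Set.Icc (0 : ℝ) 1 else {0}) ↔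
        (∀ e ∈ M, 0 ≤ x e ∧ x e ≤ 1) ∧ ∀ e ∉ M, x e = 0 := by
      rw [Set.mem_univ_pi]
      refine ⟨fun hx => ⟨fun e he => ?_, fun e he => ?_⟩, fun hx e => ?_⟩
      · simpa [he] using hx e
      · simpa [he] using hx e
      · by_cases he : e ∈ M
        · simpa [he] using hx.1 e he
        · simpa [he] using hx.2 e he
    rw [hK, Set.mem_inter_iff, this, and_assoc]
    rfl
  have hcompact : IsCompact K := by
    refine (isCompact_univ_pi fun e => ?_).inter_right
      ((isClosed_isFractionalClass M t 𝒜 p k).inter (isClosed_isFractionalClass M h ℬ q k))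
    split_ifs
    · exact isCompact_Icc
    · exact isCompact_singleton
  have hne : K.Nonempty := by
    refine ⟨fun e => if e ∈ M then (1 / k : ℝ) else 0, (hmemK _).2 ⟨fun e he => ?_, fun e he => ?_,
      isFractionalClass_const hp hk, isFractionalClass_const hq hk⟩⟩
    · have hk1 : (1 : ℝ) ≤ k := by exact_mod_cast hk
      simp only [if_pos he]
      exact ⟨by positivity, by rw [div_le_one (by linarith)]; exact hk1⟩
    · simp [he]
  obtain ⟨x, hxK, hext⟩ := hcompact.extremePoints_nonempty hne
  obtain ⟨hx01, hx0, hxA, hxB⟩ := (hmemK x).1 hxK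
  have hΦ : fractional M x = ∅ := by
    by_contra hΦ
    obtain ⟨σ, S, hS, hσ⟩ := exists_tight_classes hfinA h𝒜 hp hx01 hxA
    obtain ⟨τ, T, hT, hτ⟩ := exists_tight_classes hfinB hℬ hq hx01 hxB
    obtain ⟨w, hw0, hwΦ, hwS, hwT⟩ :=
      exists_weighting (nonempty_iff_ne_empty.2 hΦ) σ τ S T hS hT
    have hev : ∀ᶠ ε in 𝓝 (0 : ℝ), x + ε • w ∈ K := by
      have h01 : ∀ᶠ ε in 𝓝 (0 : ℝ), ∀ e ∈ fractional M x,
          0 ≤ (x + ε • w) e ∧ (x + ε • w) e ≤ 1 := by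
        refine (Filter.eventually_all_finset _).2 fun e he => ?_
        have hcont : Filter.Tendsto (fun ε : ℝ => (x + ε • w) e) (𝓝 0) (𝓝 (x e)) := by
          have : Continuous fun ε : ℝ => x e + ε * w e := by fun_prop
          simpa using this.tendsto 0
        have he' := (mem_filter.1 he).2
        filter_upwards [hcont.eventually_const_lt he'.1, hcont.eventually_lt_const he'.2]
          with ε h1 h2 using ⟨h1.le, h2.le⟩
      filter_upwards [h01, hxA.eventually hfinA (hσ w hwΦ hwS),
        hxB.eventually hfinB (hτ w hwΦ hwT)] with ε h1 h2 h3
      refine (hmemK _).2 ⟨fun e he => ?_, fun e he => ?_, h2, h3⟩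
      · by_cases heΦ : e ∈ fractional M x
        · exact h1 e heΦ
        · simpa [hwΦ e heΦ] using hx01 e he
      · have : e ∉ fractional M x := fun h => he (mem_filter.1 h).1
        simp [hwΦ e this, hx0 e he]
    obtain ⟨δ, hδ, hball⟩ := Metric.eventually_nhds_iff.1 hev
    have hplus := hball (y := δ / 2) (by
      rw [Real.dist_eq, sub_zero, abs_of_pos (by linarith)]; linarith)
    have hminus := hball (y := -(δ / 2)) (by
      rw [Real.dist_eq, sub_zero, abs_neg, abs_of_pos (by linarith)]; linarith)
    have hseg : x ∈ openSegment ℝ (x + (δ / 2) • w) (x + (-(δ / 2)) • w) := by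
      refine ⟨1 / 2, 1 / 2, by norm_num, by norm_num, by norm_num, ?_⟩
      ext e
      simp only [Pi.add_apply, Pi.smul_apply, smul_eq_mul]
      ring
    have heq : x + (δ / 2) • w = x := hext hplus hminus hseg
    refine hw0 (funext fun e => ?_)
    have := congrFun heq e
    simp only [Pi.add_apply, Pi.smul_apply, smul_eq_mul, add_eq_left, mul_eq_zero] at this
    rcases this with h | h
    · linarith
    · exact h
  have hx1 : ∀ e ∈ M, x e = if x e = 1 then 1 else 0 := by
    intro e he
    split_ifs with h
    · exact h
    · by_contra hne
      have : e ∈ fractional M x := mem_filter.2 ⟨he, lt_of_le_of_ne (hx01 e he).1 (Ne.symm hne),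
        lt_of_le_of_ne (hx01 e he).2 h⟩
      simp [hΦ] at this
  refine ⟨M.filter fun e => x e = 1, filter_subset _ _, fun X hX => ⟨fun hpX => ?_, ?_⟩,
    fun Y hY => ⟨fun hqY => ?_, ?_⟩⟩
  · have := (hxA X hX).1 hpX
    rw [sum_sect_eq_card hx1] at this
    exact card_pos.1 (by exact_mod_cast this)
  · have := (hxA X hX).2
    rw [sum_sect_eq_card hx1] at this
    exact_mod_cast this
  · have := (hxB Y hY).1 hqY
    rw [sum_sect_eq_card hx1] at this
    exact card_pos.1 (by exact_mod_cast this)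
  · have := (hxB Y hY).2
    rw [sum_sect_eq_card hx1] at this
    exact_mod_cast this

/-- The colours among the first `k` that appear in `X`. -/
noncomputable def seen (M : Finset E) (t : E → V) (c : E → ℕ) (k : ℕ) (X : Set V) : Finset ℕ :=
  (range k).filter fun i => ∃ e ∈ sect M t X, c e = i

theorem mem_seen {M : Finset E} {t : E → V} {c : E → ℕ} {k : ℕ} {X : Set V} {i : ℕ} :
    i ∈ seen M t c k X ↔ i < k ∧ ∃ e ∈ sect M t X, c e = i := by
  simp [seen]

/-- Whether `F` meets `X` is a submodular indicator, so subtracting it preserves supermodularity.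
The two conditions on `F` are what the bounds by colours and by elements need. -/
theorem IsRequirement.remove_class {M F : Finset E} {t : E → V} {𝒜 : Set (Set V)}
    {p : Set V → ℤ} {k : ℕ} (hp : IsRequirement M t 𝒜 p (k + 1)) (hF : F ⊆ M)
    (hFA : ∀ X ∈ 𝒜, (p X = (k + 1 : ℕ) → (sect F t X).Nonempty) ∧
        ((sect F t X).card : ℤ) ≤ (sect M t X).card - p X + 1) :
    IsRequirement (M \ F) t 𝒜 (fun X => p X - if (sect F t X).Nonempty then 1 else 0) k := by
  have hcard : ∀ X, ((sect (M \ F) t X).card : ℤ) = (sect M t X).card - (sect F t X).card := by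
    intro X
    have h1 : sect (M \ F) t X = sect M t X \ sect F t X := by
      ext e; simp only [mem_sect, mem_sdiff]; tauto
    have h2 : sect F t X ⊆ sect M t X := filter_subset_filter _ hF
    rw [h1, card_sdiff_of_subset h2, Nat.cast_sub (card_le_card h2)]
  refine ⟨fun X hX => ?_, fun X hX => ?_, fun X hX Y hY hXY => ?_⟩
  · have h1 := hp.le_colours X hX
    have h2 := (hFA X hX).1
    push_cast at h1 h2
    split_ifs with hne
    · omega
    · have : p X ≠ k + 1 := fun h => hne (h2 h)
      omega
  · have h1 := hp.le_card X hX
    have h2 := (hFA X hX).2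
    rw [hcard]
    split_ifs with hne
    · omega
    · rw [not_nonempty_iff_eq_empty] at hne
      rw [hne]
      simpa using h1
  · have h1 := hp.supermodular X hX Y hY hXY
    have h2 : (sect F t (X ∩ Y)).Nonempty → (sect F t X).Nonempty ∧ (sect F t Y).Nonempty := by
      rintro ⟨e, he⟩
      rw [mem_sect] at he
      exact ⟨⟨e, mem_sect.2 ⟨he.1, he.2.1⟩⟩, ⟨e, mem_sect.2 ⟨he.1, he.2.2⟩⟩⟩
    have h3 : (sect F t (X ∪ Y)).Nonempty → (sect F t X).Nonempty ∨ (sect F t Y).Nonempty := by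
      rintro ⟨e, he⟩
      rw [mem_sect] at he
      exact he.2.imp (fun h => ⟨e, mem_sect.2 ⟨he.1, h⟩⟩) fun h => ⟨e, mem_sect.2 ⟨he.1, h⟩⟩
    split_ifs <;> first | omega | (exfalso; tauto)

/-- The removed class `F` gets the fresh colour `k`, so a set meeting `F` sees one more colour. -/
theorem le_card_seen_succ {M F : Finset E} {t : E → V} {c : E → ℕ} {k : ℕ} {X : Set V} {n : ℤ}
    (hF : F ⊆ M) (h : n - (if (sect F t X).Nonempty then 1 else 0) ≤ (seen (M \ F) t c k X).card) :
    n ≤ (seen M t (fun e => if e ∈ F then k else c e) (k + 1) X).card := by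
  have hsub : seen (M \ F) t c k X ⊆ seen M t (fun e => if e ∈ F then k else c e) (k + 1) X := by
    intro i hi
    rw [mem_seen] at hi ⊢
    obtain ⟨hik, e, he, hei⟩ := hi
    rw [mem_sect, mem_sdiff] at he
    exact ⟨by omega, e, mem_sect.2 ⟨he.1.1, he.2⟩, by simp [he.1.2, hei]⟩
  split_ifs at h with hne
  · obtain ⟨e, he⟩ := hne
    rw [mem_sect] at he
    have hmem : k ∈ seen M t (fun e => if e ∈ F then k else c e) (k + 1) X :=
      mem_seen.2 ⟨by omega, e, mem_sect.2 ⟨hF he.1, he.2⟩, by simp [he.1]⟩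
    have hnot : k ∉ seen (M \ F) t c k X := fun h => by
      have := (mem_seen.1 h).1
      omega
    have := card_le_card (insert_subset hmem hsub)
    rw [card_insert_of_notMem hnot] at this
    omega
  · have := card_le_card hsub
    omega

/-- The supermodular colouring theorem of Schrijver. -/
theorem exists_supermodular_colouring {t : E → V} {h : E → W} {𝒜 : Set (Set V)}
    {ℬ : Set (Set W)} (hfinA : 𝒜.Finite) (hfinB : ℬ.Finite) (h𝒜 : IsIntersecting 𝒜)
    (hℬ : IsIntersecting ℬ) (k : ℕ) {M : Finset E} {p : Set V → ℤ} {q : Set W → ℤ}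
    (hp : IsRequirement M t 𝒜 p k) (hq : IsRequirement M h ℬ q k) :
    ∃ c : E → ℕ, (∀ X ∈ 𝒜, p X ≤ (seen M t c k X).card) ∧
      ∀ Y ∈ ℬ, q Y ≤ (seen M h c k Y).card := by
  induction k generalizing M p q with
  | zero =>
    refine ⟨fun _ => 0, fun X hX => (hp.le_colours X hX).trans ?_,
      fun Y hY => (hq.le_colours Y hY).trans ?_⟩ <;> simp
  | succ k ih =>
    obtain ⟨F, hF, hFA, hFB⟩ :=
      exists_colour_class (Nat.le_add_left 1 k) hfinA hfinB h𝒜 hℬ hp hq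
    obtain ⟨c, hcA, hcB⟩ := ih (hp.remove_class hF hFA) (hq.remove_class hF hFB)
    exact ⟨fun e => if e ∈ F then k else c e, fun X hX => le_card_seen_succ hF (hcA X hX),
      fun Y hY => le_card_seen_succ hF (hcB Y hY)⟩

/-- The requirement on `M` is what the edges of `b` cannot supply; it is supermodular because the
number of leaving edges is submodular. -/
theorem isRequirement_sub_leaving {M b : Finset E} {t h : E → V} {𝒜 : Set (Set V)} {k : ℕ}
    (hdeg : ∀ X ∈ 𝒜, k ≤ (sect M t X).card + (leaving b t h X).card) :
    IsRequirement M t 𝒜 (fun X => k - (leaving b t h X).card) k := by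
  refine ⟨fun X _ => by omega, fun X hX => ?_, fun X _ Y _ _ => ?_⟩
  · have := hdeg X hX
    omega
  · have := card_leaving_submodular b t h X Y
    omega

theorem exists_extension {M b : Finset E} {t h : E → V} {𝒜 : Set (Set V)} (hfin : 𝒜.Finite)
    (h𝒜 : IsIntersecting 𝒜) {k : ℕ} {c₀ : E → ℕ}
    (hc₀ : ∀ X ∈ 𝒜, (k - (leaving b t h X).card : ℤ) ≤ (seen M t c₀ k X).card) :
    ∃ c : E → ℕ, ∀ X ∈ 𝒜, ∀ i < k,
      (∃ e ∈ sect M t X, c₀ e = i) ∨ ∃ e ∈ leaving b t h X, c e = i := by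
  -- The tails of the elements of `M` already coloured `i` are the roots of colour `i`, so the
  -- missing colours are exactly those not seen.
  set R : ℕ → Set V := fun i => {v | ∃ e ∈ M, c₀ e = i ∧ t e = v} with hR
  have hRX : ∀ (X : Set V) (i : ℕ), (X ∩ R i).Nonempty ↔ ∃ e ∈ sect M t X, c₀ e = i := by
    intro X i
    constructor
    · rintro ⟨v, hv, e, he, hei, rfl⟩
      exact ⟨e, mem_sect.2 ⟨he, hv⟩, hei⟩
    · rintro ⟨e, he, hei⟩
      rw [mem_sect] at he
      exact ⟨t e, he.2, e, he.1, hei, rfl⟩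
  obtain ⟨c, hc⟩ := exists_branching_colouring hfin h𝒜 t h k b R (by
    intro X hX
    have h1 : (missing k R X).card + (seen M t c₀ k X).card = k := by
      have h2 : missing k R X = (range k).filter fun i => ¬ ∃ e ∈ sect M t X, c₀ e = i := by
        unfold missing
        simp only [hRX]
      rw [h2, seen, add_comm, card_filter_add_card_filter_not, card_range]
    have := hc₀ X hX
    omega)
  exact ⟨c, fun X hX i hi => by rw [← hRX]; exact hc X hX i hi⟩

/-- Disjoint bibranchings: the edges of `M` serve both families, those of `b` and `b'` one each. -/
theorem exists_bibranching_colouring {t h : E → V} {𝒜 ℬ : Set (Set V)} (hfinA : 𝒜.Finite)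
    (hfinB : ℬ.Finite) (h𝒜 : IsIntersecting 𝒜) (hℬ : IsIntersecting ℬ) {k : ℕ}
    {M b b' : Finset E} (hMb : Disjoint M b) (hMb' : Disjoint M b') (hbb' : Disjoint b b')
    (hdegA : ∀ X ∈ 𝒜, k ≤ (sect M t X).card + (leaving b t h X).card)
    (hdegB : ∀ Y ∈ ℬ, k ≤ (sect M h Y).card + (leaving b' h t Y).card) :
    ∃ c : E → ℕ,
      (∀ X ∈ 𝒜, ∀ i < k, ∃ e, (e ∈ sect M t X ∨ e ∈ leaving b t h X) ∧ c e = i) ∧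
      ∀ Y ∈ ℬ, ∀ i < k, ∃ e, (e ∈ sect M h Y ∨ e ∈ leaving b' h t Y) ∧ c e = i := by
  obtain ⟨c₀, hcA, hcB⟩ := exists_supermodular_colouring hfinA hfinB h𝒜 hℬ k
    (isRequirement_sub_leaving hdegA) (isRequirement_sub_leaving hdegB)
  obtain ⟨c₁, hc₁⟩ := exists_extension hfinA h𝒜 hcA
  obtain ⟨c₂, hc₂⟩ := exists_extension hfinB hℬ hcB
  refine ⟨fun e => if e ∈ M then c₀ e else if e ∈ b then c₁ e else c₂ e, fun X hX i hi => ?_,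
    fun Y hY i hi => ?_⟩
  · rcases hc₁ X hX i hi with ⟨e, he, hei⟩ | ⟨e, he, hei⟩
    · exact ⟨e, Or.inl he, by simp [(mem_sect.1 he).1, hei]⟩
    · have heb := (mem_leaving.1 he).1
      exact ⟨e, Or.inr he, by simp [disjoint_right.1 hMb heb, heb, hei]⟩
  · rcases hc₂ Y hY i hi with ⟨e, he, hei⟩ | ⟨e, he, hei⟩
    · exact ⟨e, Or.inl he, by simp [(mem_sect.1 he).1, hei]⟩
    · have heb := (mem_leaving.1 he).1
      exact ⟨e, Or.inr he, by simp [disjoint_right.1 hMb' heb, disjoint_right.1 hbb' heb, hei]⟩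

end SupermodularColouring

/-! ### Packing instances and gluing at a tight dicut -/

section Core

open Finset
open scoped Classical

variable {V E : Type*}

/-- Finitely many out-shores `𝒜` and in-shores `ℬ` closed under uncrossing, none of them left by
fewer than `k` of the edges in `A`. -/
structure IsPackingInstance (k : ℕ) (𝒜 ℬ : Set (Set V)) (A : Finset E) (t h : E → V) : Prop where
  finite_left : 𝒜.Finite
  finite_right : ℬ.Finite
  left : IsIntersecting 𝒜
  right : IsIntersecting ℬ
  diff_left : ∀ X ∈ 𝒜, ∀ Y ∈ ℬ, X \ Y ∈ 𝒜
  diff_right : ∀ X ∈ 𝒜, ∀ Y ∈ ℬ, Y \ X ∈ ℬ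
  closed_left : ∀ e ∈ A, ∀ X ∈ 𝒜, h e ∈ X → t e ∈ X
  closed_right : ∀ e ∈ A, ∀ Y ∈ ℬ, t e ∈ Y → h e ∈ Y
  le_card_left : ∀ X ∈ 𝒜, k ≤ (leaving A t h X).card
  le_card_right : ∀ Y ∈ ℬ, k ≤ (leaving A h t Y).card

/-- The edges can be coloured so that all of the first `k` colours appear on every dicut. -/
def IsPackable (k : ℕ) (𝒜 ℬ : Set (Set V)) (A : Finset E) (t h : E → V) : Prop :=
  ∃ c : E → ℕ, (∀ X ∈ 𝒜, ∀ i < k, ∃ e ∈ leaving A t h X, c e = i) ∧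
    ∀ Y ∈ ℬ, ∀ i < k, ∃ e ∈ leaving A h t Y, c e = i

variable {k : ℕ} {𝒜 ℬ : Set (Set V)} {A : Finset E} {t h : E → V}

theorem IsPackingInstance.swap (I : IsPackingInstance k 𝒜 ℬ A t h) :
    IsPackingInstance k ℬ 𝒜 A h t :=
  ⟨I.finite_right, I.finite_left, I.right, I.left, fun Y hY X hX => I.diff_right X hX Y hY,
    fun Y hY X hX => I.diff_left X hX Y hY, I.closed_right, I.closed_left, I.le_card_right,
    I.le_card_left⟩

theorem IsPackable.swap (H : IsPackable k 𝒜 ℬ A t h) : IsPackable k ℬ 𝒜 A h t :=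
  let ⟨c, hA, hB⟩ := H
  ⟨c, hB, hA⟩

/-- The number of edges of colour `i` leaving `X` minus the number of those entering `X`. -/
noncomputable def net (A : Finset E) (t h : E → V) (c : E → ℕ) (i : ℕ) (X : Set V) : ℤ :=
  ∑ e ∈ A with c e = i, ((if t e ∈ X then 1 else 0) - if h e ∈ X then 1 else 0)

theorem net_swap (A : Finset E) (t h : E → V) (c : E → ℕ) (i : ℕ) (X : Set V) :
    net A h t c i X = - net A t h c i X := by
  simp [net]

theorem net_eq_card (c : E → ℕ) (i : ℕ) {X : Set V} (hX : ∀ e ∈ A, h e ∈ X → t e ∈ X) :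
    net A t h c i X = ((leaving A t h X).filter fun e => c e = i).card := by
  have hcomm : (leaving A t h X).filter (fun e => c e = i) =
      (A.filter fun e => c e = i).filter fun e => t e ∈ X ∧ h e ∉ X := by
    rw [leaving, filter_comm]
  rw [net, hcomm, card_filter]
  push_cast
  refine sum_congr rfl fun e he => ?_
  have := hX e (mem_filter.1 he).1
  by_cases h1 : t e ∈ X <;> by_cases h2 : h e ∈ X <;> simp [h1, h2]
  exact h1 (this h2)

theorem net_inter_add_net_union (A : Finset E) (t h : E → V) (c : E → ℕ) (i : ℕ) (X Y : Set V) :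
    net A t h c i (X ∩ Y) + net A t h c i (X ∪ Y) = net A t h c i X + net A t h c i Y := by
  simp only [net, ← sum_add_distrib]
  refine sum_congr rfl fun e _ => ?_
  by_cases h1 : t e ∈ X <;> by_cases h2 : t e ∈ Y <;> by_cases h3 : h e ∈ X <;>
    by_cases h4 : h e ∈ Y <;> simp [h1, h2, h3, h4]

theorem net_diff_sub_net_diff (A : Finset E) (t h : E → V) (c : E → ℕ) (i : ℕ) (X Y : Set V) :
    net A t h c i (X \ Y) - net A t h c i (Y \ X) = net A t h c i X - net A t h c i Y := by
  simp only [net, ← sum_sub_distrib]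
  refine sum_congr rfl fun e _ => ?_
  by_cases h1 : t e ∈ X <;> by_cases h2 : t e ∈ Y <;> by_cases h3 : h e ∈ X <;>
    by_cases h4 : h e ∈ Y <;> simp [h1, h2, h3, h4]

/-- One half of the split at `X`. The members of `ℬ` may be dropped, since gluing treats `Y ∈ ℬ`
through `X \ Y ∈ 𝒜` inside `X` and `Y \ X ∈ ℬ` outside. -/
theorem IsPackingInstance.inside (I : IsPackingInstance k 𝒜 ℬ A t h) (X : Set V) :
    IsPackingInstance k {Z ∈ 𝒜 | Z ⊆ X} ∅ A t h where
  finite_left := I.finite_left.subset fun _ hZ => hZ.1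
  finite_right := Set.finite_empty
  left :=
    ⟨fun Z hZ => I.left.nonempty Z hZ.1,
      fun Z hZ Z' hZ' => ⟨I.left.union Z hZ.1 Z' hZ'.1, Set.union_subset hZ.2 hZ'.2⟩,
      fun Z hZ Z' hZ' hne =>
        ⟨I.left.inter Z hZ.1 Z' hZ'.1 hne, Set.inter_subset_left.trans hZ.2⟩⟩
  right := ⟨fun _ hY => hY.elim, fun _ hY => hY.elim, fun _ hY => hY.elim⟩
  diff_left := fun _ _ _ hY => hY.elim
  diff_right := fun _ _ _ hY => hY.elim
  closed_left := fun e he Z hZ => I.closed_left e he Z hZ.1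
  closed_right := fun _ _ _ hY => hY.elim
  le_card_left := fun Z hZ => I.le_card_left Z hZ.1
  le_card_right := fun _ hY => hY.elim

/-- The other half of the split: only shores that do not cut through `X` are kept, as if `X` were
contracted to a point. -/
theorem IsPackingInstance.contract (I : IsPackingInstance k 𝒜 ℬ A t h) (X : Set V) :
    IsPackingInstance k {Z ∈ 𝒜 | X ⊆ Z ∨ Disjoint X Z} {Y ∈ ℬ | Disjoint X Y} A t h where
  finite_left := I.finite_left.subset fun Z hZ => hZ.1
  finite_right := I.finite_right.subset fun Z hZ => hZ.1
  left := by
    refine ⟨fun Z hZ => I.left.nonempty Z hZ.1,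
      fun Z hZ Z' hZ' => ⟨I.left.union Z hZ.1 Z' hZ'.1, ?_⟩,
      fun Z hZ Z' hZ' hne => ⟨I.left.inter Z hZ.1 Z' hZ'.1 hne, ?_⟩⟩
    · rcases hZ.2 with h1 | h1
      · exact Or.inl (h1.trans Set.subset_union_left)
      · rcases hZ'.2 with h2 | h2
        · exact Or.inl (h2.trans Set.subset_union_right)
        · exact Or.inr (Set.disjoint_union_right.2 ⟨h1, h2⟩)
    · rcases hZ.2 with h1 | h1
      · rcases hZ'.2 with h2 | h2
        · exact Or.inl (Set.subset_inter h1 h2)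
        · exact Or.inr (h2.mono_right Set.inter_subset_right)
      · exact Or.inr (h1.mono_right Set.inter_subset_left)
  right :=
    ⟨fun Y hY => I.right.nonempty Y hY.1,
      fun Y hY Y' hY' =>
        ⟨I.right.union Y hY.1 Y' hY'.1, Set.disjoint_union_right.2 ⟨hY.2, hY'.2⟩⟩,
      fun Y hY Y' hY' hne =>
        ⟨I.right.inter Y hY.1 Y' hY'.1 hne, hY.2.mono_right Set.inter_subset_left⟩⟩
  diff_left := fun Z hZ Y hY => ⟨I.diff_left Z hZ.1 Y hY.1,
    hZ.2.imp (fun h1 => Set.subset_sdiff.2 ⟨h1, hY.2⟩) fun h1 => h1.mono_right Set.sdiff_subset⟩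
  diff_right := fun Z hZ Y hY =>
    ⟨I.diff_right Z hZ.1 Y hY.1, hY.2.mono_right Set.sdiff_subset⟩
  closed_left := fun e he Z hZ => I.closed_left e he Z hZ.1
  closed_right := fun e he Y hY => I.closed_right e he Y hY.1
  le_card_left := fun Z hZ => I.le_card_left Z hZ.1
  le_card_right := fun Y hY => I.le_card_right Y hY.1

theorem injOn_of_all_colours {δ : Finset E} {c : E → ℕ} (hδ : δ.card = k)
    (hc : ∀ i < k, ∃ e ∈ δ, c e = i) : Set.InjOn c δ ∧ ∀ e ∈ δ, c e < k := by
  have hsub : range k ⊆ δ.image c := fun i hi => by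
    obtain ⟨e, he, hei⟩ := hc i (mem_range.1 hi)
    exact mem_image.2 ⟨e, he, hei⟩
  have hle : (δ.image c).card ≤ (range k).card := by
    rw [card_range, ← hδ]
    exact card_image_le
  have heq : range k = δ.image c := eq_of_subset_of_card_le hsub hle
  refine ⟨card_image_iff.1 ?_, fun e he => ?_⟩
  · rw [← heq, card_range, hδ]
  · rw [← mem_range, heq]
    exact mem_image_of_mem c he

/-- The colours of two colourings that are both injective on a tight cut can be matched up. -/
theorem exists_matching_recolouring {δ : Finset E} {c₁ c₂ : E → ℕ} (hδ : δ.card = k)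
    (h₁ : ∀ i < k, ∃ e ∈ δ, c₁ e = i) (h₂ : ∀ i < k, ∃ e ∈ δ, c₂ e = i) :
    ∃ σ : ℕ → ℕ, (∀ e ∈ δ, σ (c₁ e) = c₂ e) ∧ ∀ j < k, ∃ i < k, σ i = j := by
  obtain ⟨hinj, hlt⟩ := injOn_of_all_colours hδ h₁
  have hσ : ∀ e ∈ δ, (if hi : ∃ f ∈ δ, c₁ f = c₁ e then c₂ hi.choose else k) = c₂ e := by
    intro e he
    have hex : ∃ f ∈ δ, c₁ f = c₁ e := ⟨e, he, rfl⟩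
    rw [dif_pos hex, hinj hex.choose_spec.1 he hex.choose_spec.2]
  -- All colours below `k` occur on `δ`, so the default value `k` is taken only by colours that do
  -- not matter.
  refine ⟨fun i => if hi : ∃ f ∈ δ, c₁ f = i then c₂ hi.choose else k, hσ, fun j hj => ?_⟩
  obtain ⟨e, he, hej⟩ := h₂ j hj
  exact ⟨c₁ e, hlt e he, (hσ e he).trans hej⟩

/-- Colourings of the two contractions at a tight dicut can be glued together. -/
theorem IsPackingInstance.glue (I : IsPackingInstance k 𝒜 ℬ A t h) {X : Set V} (hX : X ∈ 𝒜)
    (hcard : (leaving A t h X).card = k) (H₁ : IsPackable k {Z ∈ 𝒜 | Z ⊆ X} ∅ A t h)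
    (H₂ : IsPackable k {Z ∈ 𝒜 | X ⊆ Z ∨ Disjoint X Z} {Y ∈ ℬ | Disjoint X Y} A t h) :
    IsPackable k 𝒜 ℬ A t h := by
  obtain ⟨c₁, hc₁, -⟩ := H₁
  obtain ⟨c₂, hc₂A, hc₂B⟩ := H₂
  have hX₂ := hc₂A X ⟨hX, Or.inl subset_rfl⟩
  obtain ⟨σ, hσ, hσk⟩ := exists_matching_recolouring hcard (hc₁ X ⟨hX, subset_rfl⟩) hX₂
  -- After permuting its colours, `c₁` agrees with `c₂` on the edges leaving `X`. So `c` inherits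
  -- the properties of `c₁` inside `X` and those of `c₂` outside.
  set c : E → ℕ := fun e => if t e ∈ X then σ (c₁ e) else c₂ e with hc
  have hcX : ∀ e ∈ leaving A t h X, c e = c₂ e := by
    intro e he
    simp only [hc, if_pos (mem_leaving.1 he).2.1]
    exact hσ e he
  have hin : ∀ Z ∈ 𝒜, Z ⊆ X → ∀ i < k, ∃ e ∈ leaving A t h Z, c e = i := by
    intro Z hZ hZX i hi
    obtain ⟨j, hj, rfl⟩ := hσk i hi
    obtain ⟨e, he, rfl⟩ := hc₁ Z ⟨hZ, hZX⟩ j hj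
    exact ⟨e, he, by simp only [hc, if_pos (hZX (mem_leaving.1 he).2.1)]⟩
  have hout : ∀ Z ∈ 𝒜, X ⊆ Z ∨ Disjoint X Z → ∀ i < k, ∃ e ∈ leaving A t h Z, c e = i := by
    intro Z hZ hXZ i hi
    obtain ⟨e, he, rfl⟩ := hc₂A Z ⟨hZ, hXZ⟩ i hi
    refine ⟨e, he, ?_⟩
    by_cases hte : t e ∈ X
    · have he' := mem_leaving.1 he
      rcases hXZ with hXZ | hXZ
      · exact hcX e (mem_leaving.2 ⟨he'.1, hte, fun hhe => he'.2.2 (hXZ hhe)⟩)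
      · exact absurd he'.2.1 (Set.disjoint_left.1 hXZ hte)
    · simp only [hc, if_neg hte]
  have hright : ∀ Y ∈ ℬ, Disjoint X Y → ∀ i < k, ∃ e ∈ leaving A h t Y, c e = i := by
    intro Y hY hXY i hi
    obtain ⟨e, he, rfl⟩ := hc₂B Y ⟨hY, hXY⟩ i hi
    refine ⟨e, he, ?_⟩
    by_cases hte : t e ∈ X
    · have he' := mem_leaving.1 he
      exact hcX e (mem_leaving.2 ⟨he'.1, hte, Set.disjoint_right.1 hXY he'.2.1⟩)
    · simp only [hc, if_neg hte]
  -- Tightness of `X` enters here. For a crossing `Z`, both `X ∩ Z` and `X ∪ Z` have net at least 1,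
  -- so modularity of `net` leaves at least 1 for `Z`; a member of `ℬ` is handled in the same way by
  -- differences.
  have hnetX : ∀ i, net A t h c i X ≤ 1 := by
    intro i
    rw [net_eq_card c i fun e he => I.closed_left e he X hX]
    have hinj := (injOn_of_all_colours hcard hX₂).1
    have : ((leaving A t h X).filter fun e => c e = i).card ≤ 1 := by
      refine card_le_one.2 fun e he f hf => ?_
      rw [mem_filter] at he hf
      refine hinj he.1 hf.1 ?_
      rw [← hcX e he.1, ← hcX f hf.1, he.2, hf.2]
    exact_mod_cast this
  have hposA : ∀ Z ∈ 𝒜, ∀ i, 1 ≤ net A t h c i Z ↔ ∃ e ∈ leaving A t h Z, c e = i := by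
    intro Z hZ i
    rw [net_eq_card c i fun e he => I.closed_left e he Z hZ]
    rw [Nat.one_le_cast, Nat.one_le_iff_ne_zero, ← Nat.pos_iff_ne_zero, card_pos]
    simp [Finset.Nonempty, mem_filter]
  have hposB : ∀ Y ∈ ℬ, ∀ i, 1 ≤ - net A t h c i Y ↔ ∃ e ∈ leaving A h t Y, c e = i := by
    intro Y hY i
    rw [← net_swap, net_eq_card c i fun e he => I.closed_right e he Y hY]
    rw [Nat.one_le_cast, Nat.one_le_iff_ne_zero, ← Nat.pos_iff_ne_zero, card_pos]
    simp [Finset.Nonempty, mem_filter]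
  refine ⟨c, fun Z hZ i hi => ?_, fun Y hY i hi => ?_⟩
  · rcases (X ∩ Z).eq_empty_or_nonempty with hemp | hne
    · exact hout Z hZ (Or.inr (Set.disjoint_iff_inter_eq_empty.2 hemp)) i hi
    · have hI := I.left.inter X hX Z hZ hne
      have hU := I.left.union X hX Z hZ
      have h1 := (hposA _ hI i).2 (hin _ hI Set.inter_subset_left i hi)
      have h2 := (hposA _ hU i).2 (hout _ hU (Or.inl Set.subset_union_left) i hi)
      have h3 := net_inter_add_net_union A t h c i X Z
      have h4 := hnetX i
      exact (hposA Z hZ i).1 (by omega)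
  · have hXY := I.diff_left X hX Y hY
    have hYX := I.diff_right X hX Y hY
    have h1 := (hposA _ hXY i).2 (hin _ hXY Set.sdiff_subset i hi)
    have h2 := (hposB _ hYX i).2 (hright _ hYX Set.disjoint_sdiff_right i hi)
    have h3 := net_diff_sub_net_diff A t h c i X Y
    have h4 := hnetX i
    exact (hposB Y hY i).1 (by omega)

end Core

/-! ### Reductions and the finite packing theorem -/

section CoreInduction

open Finset
open scoped Classical

variable {V E : Type*} {k : ℕ} {𝒜 ℬ : Set (Set V)} {A : Finset E} {t h : E → V}

/-- With one side only, this is the packing of disjoint branchings: all edges are put into `b` and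
no colour has a root. -/
theorem IsPackingInstance.packable_of_right_empty (I : IsPackingInstance k 𝒜 ∅ A t h) :
    IsPackable k 𝒜 ∅ A t h := by
  obtain ⟨c, hc, -⟩ := exists_bibranching_colouring (t := t) (h := h) (M := ∅) (b := A) (b' := ∅)
    I.finite_left I.finite_right I.left I.right (disjoint_empty_left _) (disjoint_empty_left _)
    (disjoint_empty_right _) (fun X hX => (I.le_card_left X hX).trans (Nat.le_add_left _ _))
    fun _ hY => hY.elim
  refine ⟨c, fun X hX i hi => ?_, fun _ hY => hY.elim⟩
  obtain ⟨e, he, hei⟩ := hc X hX i hi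
  rcases he with he | he
  · simp [sect] at he
  · exact ⟨e, he, hei⟩

theorem leaving_erase (A : Finset E) (t h : E → V) (X : Set V) (e : E) :
    leaving (A.erase e) t h X = (leaving A t h X).erase e := by
  ext f
  simp only [mem_leaving, mem_erase]
  tauto

theorem le_card_leaving_erase {X : Set V} {e : E} (hle : k ≤ (leaving A t h X).card)
    (he : e ∈ leaving A t h X → (leaving A t h X).card ≠ k) :
    k ≤ (leaving (A.erase e) t h X).card := by
  rw [leaving_erase]
  by_cases hmem : e ∈ leaving A t h X
  · rw [card_erase_of_mem hmem]
    have := he hmem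
    omega
  · rwa [erase_eq_of_notMem hmem]

/-- Edges that are in no tight dicut can be deleted. -/
theorem IsPackingInstance.erase (I : IsPackingInstance k 𝒜 ℬ A t h) {e : E}
    (heA : ∀ X ∈ 𝒜, e ∈ leaving A t h X → (leaving A t h X).card ≠ k)
    (heB : ∀ Y ∈ ℬ, e ∈ leaving A h t Y → (leaving A h t Y).card ≠ k) :
    IsPackingInstance k 𝒜 ℬ (A.erase e) t h where
  finite_left := I.finite_left
  finite_right := I.finite_right
  left := I.left
  right := I.right
  diff_left := I.diff_left
  diff_right := I.diff_right
  closed_left := fun f hf => I.closed_left f (mem_of_mem_erase hf)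
  closed_right := fun f hf => I.closed_right f (mem_of_mem_erase hf)
  le_card_left := fun X hX => le_card_leaving_erase (I.le_card_left X hX) (heA X hX)
  le_card_right := fun Y hY => le_card_leaving_erase (I.le_card_right Y hY) (heB Y hY)

theorem IsPackable.of_erase {e : E} (H : IsPackable k 𝒜 ℬ (A.erase e) t h) :
    IsPackable k 𝒜 ℬ A t h := by
  obtain ⟨c, hA, hB⟩ := H
  refine ⟨c, fun X hX i hi => ?_, fun Y hY i hi => ?_⟩
  · obtain ⟨f, hf, hfi⟩ := hA X hX i hi
    rw [leaving_erase] at hf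
    exact ⟨f, mem_of_mem_erase hf, hfi⟩
  · obtain ⟨f, hf, hfi⟩ := hB Y hY i hi
    rw [leaving_erase] at hf
    exact ⟨f, mem_of_mem_erase hf, hfi⟩

/-- The spliced edge keeps the name `e₁`, with its head moved to that of `e₂`. -/
theorem card_leaving_splice {e₁ e₂ : E} (h₁ : e₁ ∈ A) (h₂ : e₂ ∈ A) (hne : e₁ ≠ e₂) (X : Set V) :
    (leaving A t h X).card + (if t e₁ ∈ X ∧ h e₂ ∉ X then 1 else 0) =
      (leaving (A.erase e₂) t (Function.update h e₁ (h e₂)) X).card +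
        (if t e₁ ∈ X ∧ h e₁ ∉ X then 1 else 0) + if t e₂ ∈ X ∧ h e₂ ∉ X then 1 else 0 := by
  have h₁' : e₁ ∈ A.erase e₂ := mem_erase.2 ⟨hne, h₁⟩
  simp only [leaving, card_filter]
  rw [← add_sum_erase A _ h₂, ← add_sum_erase (A.erase e₂) _ h₁',
    ← add_sum_erase (A.erase e₂) (fun i => if t i ∈ X ∧ Function.update h e₁ (h e₂) i ∉ X
      then 1 else 0) h₁']
  have hrest : ∑ i ∈ (A.erase e₂).erase e₁,
      (if t i ∈ X ∧ Function.update h e₁ (h e₂) i ∉ X then 1 else 0) =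
      ∑ i ∈ (A.erase e₂).erase e₁, if t i ∈ X ∧ h i ∉ X then 1 else 0 := by
    refine sum_congr rfl fun e he => ?_
    rw [Function.update_of_ne (mem_erase.1 he).1]
  rw [hrest, Function.update_self]
  omega

/-- The conditions under which an edge `e₂`, and an edge `e₁` whose head lies above the tail of
`e₂`, can be replaced by a single edge from the tail of `e₁` to the head of `e₂`. -/
structure CanSplice (𝒜 ℬ : Set (Set V)) (A : Finset E) (t h : E → V) (e₁ e₂ : E) : Prop where
  mem₁ : e₁ ∈ A
  mem₂ : e₂ ∈ A
  ne : e₁ ≠ e₂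
  notMem_left : ∀ X ∈ 𝒜, h e₂ ∉ X
  notMem_right : ∀ Y ∈ ℬ, t e₁ ∉ Y
  below_left : ∀ X ∈ 𝒜, h e₁ ∈ X → t e₂ ∈ X
  below_right : ∀ Y ∈ ℬ, t e₂ ∈ Y → h e₁ ∈ Y

/-- A member of `𝒜` loses at most one leaving edge, and only if it contains the tail of `e₂`; such
members are not tight by assumption. Dually for `ℬ` and the head of `e₁`. -/
theorem IsPackingInstance.splice (I : IsPackingInstance k 𝒜 ℬ A t h) {e₁ e₂ : E}
    (hs : CanSplice 𝒜 ℬ A t h e₁ e₂)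
    (hA : ∀ X ∈ 𝒜, t e₂ ∈ X → (leaving A t h X).card ≠ k)
    (hB : ∀ Y ∈ ℬ, h e₁ ∈ Y → (leaving A h t Y).card ≠ k) :
    IsPackingInstance k 𝒜 ℬ (A.erase e₂) t (Function.update h e₁ (h e₂)) where
  finite_left := I.finite_left
  finite_right := I.finite_right
  left := I.left
  right := I.right
  diff_left := I.diff_left
  diff_right := I.diff_right
  closed_left := by
    intro f hf X hX hhf
    by_cases hfe : f = e₁
    · subst hfe
      rw [Function.update_self] at hhf
      exact absurd hhf (hs.notMem_left X hX)
    · rw [Function.update_of_ne hfe] at hhf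
      exact I.closed_left f (mem_of_mem_erase hf) X hX hhf
  closed_right := by
    intro f hf Y hY htf
    by_cases hfe : f = e₁
    · subst hfe
      exact absurd htf (hs.notMem_right Y hY)
    · rw [Function.update_of_ne hfe]
      exact I.closed_right f (mem_of_mem_erase hf) Y hY htf
  le_card_left := by
    intro X hX
    have h1 := card_leaving_splice (t := t) (h := h) hs.mem₁ hs.mem₂ hs.ne X
    have h2 := I.le_card_left X hX
    have h3 := hA X hX
    have h4 := hs.notMem_left X hX
    have h5 := hs.below_left X hX
    have h6 := I.closed_left e₁ hs.mem₁ X hX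
    by_cases p1 : t e₁ ∈ X <;> by_cases p2 : h e₁ ∈ X <;> by_cases p3 : t e₂ ∈ X <;>
      simp [p1, p2, p3, h4] at h1 h3 h5 h6 <;> omega
  le_card_right := by
    intro Y hY
    have h1 := card_leaving_splice (t := t) (h := h) hs.mem₁ hs.mem₂ hs.ne Yᶜ
    have h2 := I.le_card_right Y hY
    have h3 := hB Y hY
    have h4 := hs.notMem_right Y hY
    have h5 := hs.below_right Y hY
    have h6 := I.closed_right e₂ hs.mem₂ Y hY
    have hcompl : ∀ (A : Finset E) (h : E → V), leaving A t h Yᶜ = leaving A h t Y := by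
      intro A h
      ext f
      simp only [mem_leaving, Set.mem_compl_iff, not_not]
      tauto
    rw [hcompl, hcompl] at h1
    by_cases p1 : h e₂ ∈ Y <;> by_cases p2 : h e₁ ∈ Y <;> by_cases p3 : t e₂ ∈ Y <;>
      simp [p1, p2, p3, h4] at h1 h3 h5 h6 <;> omega

/-- Both `e₁` and `e₂` get the colour of the spliced edge: any shore left by that edge is left by
one of them, by the two "below" conditions. -/
theorem IsPackable.of_splice {e₁ e₂ : E} (hs : CanSplice 𝒜 ℬ A t h e₁ e₂)
    (H : IsPackable k 𝒜 ℬ (A.erase e₂) t (Function.update h e₁ (h e₂))) :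
    IsPackable k 𝒜 ℬ A t h := by
  obtain ⟨c, hA, hB⟩ := H
  refine ⟨Function.update c e₂ (c e₁), fun X hX i hi => ?_, fun Y hY i hi => ?_⟩
  · obtain ⟨f, hf, rfl⟩ := hA X hX i hi
    rw [mem_leaving, mem_erase] at hf
    obtain ⟨⟨hfe₂, hfA⟩, htf, hhf⟩ := hf
    by_cases hfe : f = e₁
    · subst hfe
      rw [Function.update_self] at hhf
      by_cases hX₁ : h f ∈ X
      · exact ⟨e₂, mem_leaving.2 ⟨hs.mem₂, hs.below_left X hX hX₁, hhf⟩, by simp⟩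
      · exact ⟨f, mem_leaving.2 ⟨hfA, htf, hX₁⟩, by simp [hfe₂]⟩
    · rw [Function.update_of_ne hfe] at hhf
      exact ⟨f, mem_leaving.2 ⟨hfA, htf, hhf⟩, by simp [hfe₂]⟩
  · obtain ⟨f, hf, rfl⟩ := hB Y hY i hi
    rw [mem_leaving, mem_erase] at hf
    obtain ⟨⟨hfe₂, hfA⟩, hhf, htf⟩ := hf
    by_cases hfe : f = e₁
    · subst hfe
      rw [Function.update_self] at hhf
      by_cases hY₂ : t e₂ ∈ Y
      · exact ⟨f, mem_leaving.2 ⟨hfA, hs.below_right Y hY hY₂, htf⟩, by simp [hfe₂]⟩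
      · exact ⟨e₂, mem_leaving.2 ⟨hs.mem₂, hhf, hY₂⟩, by simp⟩
    · rw [Function.update_of_ne hfe] at hhf
      exact ⟨f, mem_leaving.2 ⟨hfA, hhf, htf⟩, by simp [hfe₂]⟩

/-- The union of the minimal members of a family. -/
def minimalPart (𝒜 : Set (Set V)) : Set V :=
  ⋃₀ {X | Minimal (· ∈ 𝒜) X}

theorem IsPackingInstance.disjoint_minimalPart (I : IsPackingInstance k 𝒜 ℬ A t h) {Y : Set V}
    (hY : Y ∈ ℬ) : Disjoint Y (minimalPart 𝒜) := by
  rw [Set.disjoint_left]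
  rintro v hv ⟨X, hX, hvX⟩
  have : X ⊆ X \ Y := hX.2 (I.diff_left X hX.1 Y hY) Set.sdiff_subset
  exact (this hvX).2 hv

/-- The part of a family that avoids the points in `Q` is again intersecting. -/
theorem IsIntersecting.avoiding (h𝒜 : IsIntersecting 𝒜) (Q : Set V) :
    IsIntersecting {X ∈ 𝒜 | Disjoint X Q} :=
  ⟨fun X hX => h𝒜.nonempty X hX.1,
    fun X hX Y hY => ⟨h𝒜.union X hX.1 Y hY.1, Set.disjoint_union_left.2 ⟨hX.2, hY.2⟩⟩,
    fun X hX Y hY hne =>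
      ⟨h𝒜.inter X hX.1 Y hY.1 hne, hX.2.mono_left Set.inter_subset_left⟩⟩

/-- If nothing can be spliced, then covering the members of `𝒜` that avoid the tails of the edges
that serve `ℬ` only suffices. -/
theorem IsPackingInstance.exists_core (I : IsPackingInstance k 𝒜 ℬ A t h) {M b b' : Finset E}
    (hM : ∀ e ∈ M, ∀ X ∈ 𝒜, h e ∉ X)
    (hb' : ∀ e ∈ b', t e ∉ minimalPart 𝒜)
    (hsplice : ∀ e₁ ∈ b, ∀ e₂ ∈ b', (∀ X ∈ 𝒜, h e₁ ∈ X → t e₂ ∈ X) →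
      ∃ Y ∈ ℬ, t e₂ ∈ Y ∧ h e₁ ∉ Y) {X : Set V} (hX : X ∈ 𝒜) :
    ∃ X' ∈ {Z ∈ 𝒜 | Disjoint Z (t '' b')}, ∀ e, e ∈ sect M t X' ∨ e ∈ leaving b t h X' →
      t e ∈ X ∧ h e ∉ X := by
  -- The required `X'` is the largest member inside `X` that avoids the tails of `b'`. Minimal
  -- members avoid these tails, so there is one.
  set 𝒰 : Set (Set V) := {Z ∈ 𝒜 | Disjoint Z (t '' b') ∧ Z ⊆ X} with h𝒰
  have hsub : 𝒰 ⊆ {Z ∈ 𝒜 | Disjoint Z (t '' b')} := fun Z hZ => ⟨hZ.1, hZ.2.1⟩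
  have hne : 𝒰.Nonempty := by
    obtain ⟨Z, hZX, hZ⟩ := I.finite_left.exists_le_minimal hX
    refine ⟨Z, hZ.1, ?_, hZX⟩
    rw [Set.disjoint_right]
    rintro _ ⟨e, he, rfl⟩ hte
    exact hb' e he ⟨Z, hZ, hte⟩
  have hmem := (I.left.avoiding (t '' b')).sUnion_mem
    (I.finite_left.subset fun Z hZ => hZ.1) hsub hne
  have hsubX : ⋃₀ 𝒰 ⊆ X := Set.sUnion_subset fun Z hZ => hZ.2.2
  refine ⟨⋃₀ 𝒰, hmem, fun e he => ?_⟩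
  rcases he with he | he
  · rw [mem_sect] at he
    exact ⟨hsubX he.2, hM e he.1 X hX⟩
  · rw [mem_leaving] at he
    refine ⟨hsubX he.2.1, fun hhX => he.2.2 ?_⟩
    -- The smallest member containing the head of `e` lies in `X`. If it avoided the tails of `b'`,
    -- it would lie in `X'`, but `e` leaves `X'`. If it contained the tail of some `e₂ ∈ b'`, the
    -- set `Y` from `hsplice` would make `X \ Y` a member with the head of `e` but without that
    -- tail.
    have hfin : {Z ∈ 𝒜 | h e ∈ Z}.Finite := I.finite_left.subset fun Z hZ => hZ.1
    have hZ₀ := I.left.sInter_mem hfin (fun Z hZ => hZ.1) ⟨X, hX, hhX⟩ (v := h e)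
      fun Z hZ => hZ.2
    refine ⟨⋂₀ {Z ∈ 𝒜 | h e ∈ Z}, ⟨hZ₀, ?_, Set.sInter_subset_of_mem ⟨hX, hhX⟩⟩,
      fun Z hZ => hZ.2⟩
    rw [Set.disjoint_right]
    rintro _ ⟨e₂, he₂, rfl⟩ hte₂
    have hbelow : ∀ Z ∈ 𝒜, h e ∈ Z → t e₂ ∈ Z := fun Z hZ hhZ => hte₂ Z ⟨hZ, hhZ⟩
    obtain ⟨Y, hY, htY, hhY⟩ := hsplice e he.1 e₂ he₂ hbelow
    exact (hbelow _ (I.diff_left X hX Y hY) ⟨hhX, hhY⟩).2 htY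

/-- The case in which no reduction is possible. -/
theorem IsPackingInstance.packable_of_irreducible (I : IsPackingInstance k 𝒜 ℬ A t h)
    (hmin : ∀ e ∈ A, t e ∈ minimalPart 𝒜 ∨ h e ∈ minimalPart ℬ)
    (hsplice : ∀ e₁ ∈ A, ∀ e₂ ∈ A, t e₁ ∈ minimalPart 𝒜 → h e₁ ∉ minimalPart ℬ →
      t e₂ ∉ minimalPart 𝒜 → h e₂ ∈ minimalPart ℬ → ¬ CanSplice 𝒜 ℬ A t h e₁ e₂) :
    IsPackable k 𝒜 ℬ A t h := by
  set S := minimalPart 𝒜 with hS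
  set T := minimalPart ℬ with hT
  have hSB : ∀ Y ∈ ℬ, ∀ v ∈ S, v ∉ Y := fun Y hY v hv =>
    Set.disjoint_right.1 (I.disjoint_minimalPart hY) hv
  have hTA : ∀ X ∈ 𝒜, ∀ v ∈ T, v ∉ X := fun X hX v hv =>
    Set.disjoint_right.1 (I.swap.disjoint_minimalPart hX) hv
  set M := A.filter fun e => t e ∈ S ∧ h e ∈ T with hM
  set b := A.filter fun e => t e ∈ S ∧ h e ∉ T with hb
  set b' := A.filter fun e => t e ∉ S ∧ h e ∈ T with hb'
  have hnosplice : ∀ e₁ ∈ b, ∀ e₂ ∈ b',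
      ¬ ((∀ X ∈ 𝒜, h e₁ ∈ X → t e₂ ∈ X) ∧ ∀ Y ∈ ℬ, t e₂ ∈ Y → h e₁ ∈ Y) := by
    intro e₁ h₁ e₂ h₂ hcon
    rw [mem_filter] at h₁ h₂
    refine hsplice e₁ h₁.1 e₂ h₂.1 h₁.2.1 h₁.2.2 h₂.2.1 h₂.2.2 ⟨h₁.1, h₂.1, ?_,
      fun X hX => hTA X hX _ h₂.2.2, fun Y hY => hSB Y hY _ h₁.2.1, hcon.1, hcon.2⟩
    rintro rfl
    exact h₁.2.2 h₂.2.2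
  have hcoreA : ∀ X ∈ 𝒜, ∃ X' ∈ {Z ∈ 𝒜 | Disjoint Z (t '' b')}, ∀ e,
      e ∈ sect M t X' ∨ e ∈ leaving b t h X' → t e ∈ X ∧ h e ∉ X := by
    refine fun X hX => I.exists_core (fun e he X hX => hTA X hX _ (mem_filter.1 he).2.2)
      (fun e he => (mem_filter.1 he).2.1) (fun e₁ h₁ e₂ h₂ hbelow => ?_) hX
    by_contra! hcon
    exact hnosplice e₁ h₁ e₂ h₂ ⟨hbelow, hcon⟩
  have hcoreB : ∀ Y ∈ ℬ, ∃ Y' ∈ {Z ∈ ℬ | Disjoint Z (h '' b)}, ∀ e,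
      e ∈ sect M h Y' ∨ e ∈ leaving b' h t Y' → h e ∈ Y ∧ t e ∉ Y := by
    refine fun Y hY => I.swap.exists_core (fun e he Y hY => hSB Y hY _ (mem_filter.1 he).2.1)
      (fun e he => (mem_filter.1 he).2.2) (fun e₂ h₂ e₁ h₁ hbelow => ?_) hY
    by_contra! hcon
    exact hnosplice e₁ h₁ e₂ h₂ ⟨hcon, hbelow⟩
  -- A member avoiding the tails of `b'` is left only by edges of `M` and `b`, so the degree
  -- condition carries over; dually on the other side.
  obtain ⟨c, hcA, hcB⟩ := exists_bibranching_colouring (t := t) (h := h) (k := k)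
    (M := M) (b := b) (b' := b')
    (I.finite_left.subset fun X hX => hX.1 : {Z ∈ 𝒜 | Disjoint Z (t '' b')}.Finite)
    (I.finite_right.subset fun X hX => hX.1 : {Z ∈ ℬ | Disjoint Z (h '' b)}.Finite)
    (I.left.avoiding _) (I.right.avoiding _)
    (disjoint_filter.2 fun e _ h1 h2 => h2.2 h1.2) (disjoint_filter.2 fun e _ h1 h2 => h2.1 h1.1)
    (disjoint_filter.2 fun e _ h1 h2 => h2.1 h1.1)
    (fun X hX => by
      refine (I.le_card_left X hX.1).trans ((card_le_card fun e he => ?_).trans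
        (card_union_le (sect M t X) (leaving b t h X)))
      rw [mem_leaving] at he
      rw [mem_union, mem_sect, mem_leaving, mem_filter, mem_filter]
      have h1 := hmin e he.1
      have h2 : e ∉ b' := fun h2 => Set.disjoint_left.1 hX.2 he.2.1 ⟨e, h2, rfl⟩
      rw [mem_filter] at h2
      tauto)
    (fun Y hY => by
      refine (I.le_card_right Y hY.1).trans ((card_le_card fun e he => ?_).trans
        (card_union_le (sect M h Y) (leaving b' h t Y)))
      rw [mem_leaving] at he
      rw [mem_union, mem_sect, mem_leaving, mem_filter, mem_filter]
      have h1 := hmin e he.1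
      have h2 : e ∉ b := fun h2 => Set.disjoint_left.1 hY.2 he.2.1 ⟨e, h2, rfl⟩
      rw [mem_filter] at h2
      tauto)
  have hmemA : ∀ {f : E → V} {g : E → V} {X Y : Set V} {e : E} {B : Finset E}, B ⊆ A →
      e ∈ sect M f X ∨ e ∈ leaving B f g Y → e ∈ A := by
    rintro f g X Y e B hBA (he | he)
    · exact (mem_filter.1 (mem_sect.1 he).1).1
    · exact hBA (mem_leaving.1 he).1
  refine ⟨c, fun X hX i hi => ?_, fun Y hY i hi => ?_⟩
  · obtain ⟨X', hX', hsub⟩ := hcoreA X hX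
    obtain ⟨e, he, hei⟩ := hcA X' hX' i hi
    exact ⟨e, mem_leaving.2 ⟨hmemA (filter_subset _ _) he, hsub e he⟩, hei⟩
  · obtain ⟨Y', hY', hsub⟩ := hcoreB Y hY
    obtain ⟨e, he, hei⟩ := hcB Y' hY' i hi
    exact ⟨e, mem_leaving.2 ⟨hmemA (filter_subset _ _) he, hsub e he⟩, hei⟩

/-- Gluing at a tight set that is not minimal, given the result for smaller instances. -/
theorem IsPackingInstance.packable_of_tight (I : IsPackingInstance k 𝒜 ℬ A t h)
    (hℬ : ℬ.Nonempty)
    (ih : ∀ 𝒜' ℬ' : Set (Set V), 𝒜'.ncard + ℬ'.ncard < 𝒜.ncard + ℬ.ncard →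
      IsPackingInstance k 𝒜' ℬ' A t h → IsPackable k 𝒜' ℬ' A t h)
    {X : Set V} (hX : X ∈ 𝒜) (hcard : (leaving A t h X).card = k)
    (hXmin : ¬ Minimal (· ∈ 𝒜) X) : IsPackable k 𝒜 ℬ A t h := by
  refine I.glue hX hcard (ih _ _ ?_ (I.inside X)) (ih _ _ ?_ (I.contract X))
  · have h1 := Set.ncard_le_ncard (s := {Z ∈ 𝒜 | Z ⊆ X}) (fun Z hZ => hZ.1) I.finite_left
    have h2 := (Set.ncard_pos I.finite_right).2 hℬ
    rw [Set.ncard_empty]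
    omega
  · obtain ⟨Z, hZ, hZX, hXZ⟩ : ∃ Z ∈ 𝒜, Z ⊆ X ∧ ¬ X ⊆ Z := by
      by_contra! hcon
      exact hXmin ⟨hX, fun Z hZ hZX => hcon Z hZ hZX⟩
    have h1 : {Z ∈ 𝒜 | X ⊆ Z ∨ Disjoint X Z}.ncard < 𝒜.ncard := by
      refine Set.ncard_lt_ncard ⟨fun Z hZ => hZ.1, fun hcon => ?_⟩ I.finite_left
      rcases (hcon hZ).2 with h2 | h2
      · exact hXZ h2
      · obtain ⟨v, hv⟩ := I.left.nonempty Z hZ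
        exact Set.disjoint_left.1 h2 (hZX hv) hv
    have h2 := Set.ncard_le_ncard (s := {Y ∈ ℬ | Disjoint X Y}) (fun Y hY => hY.1) I.finite_right
    omega

/-- The finite packing theorem: the edges can be coloured with `k` colours so that every colour
appears on every dicut of the instance. -/
theorem IsPackingInstance.packable {𝒜 ℬ : Set (Set V)} {A : Finset E} {t h : E → V}
    (I : IsPackingInstance k 𝒜 ℬ A t h) : IsPackable k 𝒜 ℬ A t h := by
  obtain ⟨n, hn⟩ : ∃ n, n = 𝒜.ncard + ℬ.ncard + A.card := ⟨_, rfl⟩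
  induction n using Nat.strong_induction_on generalizing 𝒜 ℬ A t h with
  | _ n ih =>
    rcases ℬ.eq_empty_or_nonempty with rfl | hℬ
    · exact I.packable_of_right_empty
    rcases 𝒜.eq_empty_or_nonempty with rfl | h𝒜
    · exact I.swap.packable_of_right_empty.swap
    -- Once gluing is impossible, every tight shore is minimal. Shores containing a point outside
    -- the minimal part are then not tight, which is what splicing requires.
    by_cases htA : ∀ X ∈ 𝒜, (leaving A t h X).card = k → Minimal (· ∈ 𝒜) X
    swap
    · push Not at htA
      obtain ⟨X, hX, hcard, hmin⟩ := htA
      exact I.packable_of_tight hℬ (fun 𝒜' ℬ' hlt I' => ih _ (by omega) I' rfl) hX hcard hmin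
    by_cases htB : ∀ Y ∈ ℬ, (leaving A h t Y).card = k → Minimal (· ∈ ℬ) Y
    swap
    · push Not at htB
      obtain ⟨Y, hY, hcard, hmin⟩ := htB
      exact (I.swap.packable_of_tight h𝒜
        (fun 𝒜' ℬ' hlt I' => (ih _ (by omega) I'.swap rfl).swap) hY hcard hmin).swap
    by_cases herase : ∃ e ∈ A, (∀ X ∈ 𝒜, e ∈ leaving A t h X → (leaving A t h X).card ≠ k) ∧
        ∀ Y ∈ ℬ, e ∈ leaving A h t Y → (leaving A h t Y).card ≠ k
    · obtain ⟨e, he, heA, heB⟩ := herase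
      have := card_erase_lt_of_mem he
      exact (ih _ (by omega) (I.erase heA heB) rfl).of_erase
    by_cases hsplice : ∃ e₁ e₂, t e₂ ∉ minimalPart 𝒜 ∧ h e₁ ∉ minimalPart ℬ ∧
        CanSplice 𝒜 ℬ A t h e₁ e₂
    · obtain ⟨e₁, e₂, h₂, h₁, hs⟩ := hsplice
      have := card_erase_lt_of_mem hs.mem₂
      exact (ih _ (by omega) (I.splice hs (fun X hX hte hcard => h₂ ⟨X, htA X hX hcard, hte⟩)
        fun Y hY hhe hcard => h₁ ⟨Y, htB Y hY hcard, hhe⟩) rfl).of_splice hs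
    refine I.packable_of_irreducible (fun e he => ?_) fun e₁ _ e₂ _ _ h₁ h₂ _ hs =>
      hsplice ⟨e₁, e₂, h₂, h₁, hs⟩
    by_contra! hcon
    refine herase ⟨e, he, fun X hX hleave hcard => hcon.1 ⟨X, htA X hX hcard, ?_⟩,
      fun Y hY hleave hcard => hcon.2 ⟨Y, htB Y hY hcard, ?_⟩⟩
    · exact (mem_leaving.1 hleave).2.1
    · exact (mem_leaving.1 hleave).2.1

end CoreInduction

/-! ### Shores of source-sink dicuts -/

section Digraph

open Finset

variable {V E : Type*}

/-- The digraph with all edges reversed. -/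
def reversed (D : MultiDigraph V E) : MultiDigraph V E :=
  ⟨D.head, D.tail⟩

theorem reversed_adj {D : MultiDigraph V E} {x y : V} : (reversed D).Adj x y ↔ D.Adj y x := by
  simp only [MultiDigraph.Adj, reversed]
  exact exists_congr fun e => and_comm

theorem reversed_reachable {D : MultiDigraph V E} {x y : V} :
    (reversed D).Reachable x y ↔ D.Reachable y x := by
  unfold MultiDigraph.Reachable
  rw [← Relation.reflTransGen_swap]
  have : (reversed D).Adj = Function.swap D.Adj := by
    ext a b; exact reversed_adj
  rw [this]

theorem reversed_isStrongComponent {D : MultiDigraph V E} {C : Set V} :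
    (reversed D).IsStrongComponent C ↔ D.IsStrongComponent C := by
  simp only [MultiDigraph.IsStrongComponent, reversed_reachable]
  refine exists_congr fun x => ?_
  simp only [and_comm]

theorem reversed_isSourceComponent {D : MultiDigraph V E} {C : Set V} :
    (reversed D).IsSourceComponent C ↔ D.IsSinkComponent C :=
  and_congr reversed_isStrongComponent Iff.rfl

theorem reversed_isBackRay {D : MultiDigraph V E} {C : Set V} :
    (reversed D).IsBackRay C ↔ D.IsOutRay C := by
  simp only [MultiDigraph.IsBackRay, MultiDigraph.IsOutRay, reversed_adj]

/-- No edge enters `X`. -/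
def IsInClosed (D : MultiDigraph V E) (X : Set V) : Prop :=
  ∀ e, D.head e ∈ X → D.tail e ∈ X

theorem IsInClosed.mem_of_reachable {D : MultiDigraph V E} {X : Set V} (hX : IsInClosed D X)
    {x y : V} (hxy : D.Reachable x y) (hy : y ∈ X) : x ∈ X := by
  induction hxy using Relation.ReflTransGen.head_induction_on with
  | refl => exact hy
  | head hab _ ih =>
    obtain ⟨e, rfl, rfl⟩ := hab
    exact hX e ih

/-- There is a backward walk of length `n` from `y` to a vertex that cannot be reached from `y`. -/
def Escapes (D : MultiDigraph V E) : ℕ → V → V → Prop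
  | 0, y, a => y = a
  | n + 1, y, a => ∃ z, D.Adj z y ∧ Escapes D n z a

theorem exists_escapes {D : MultiDigraph V E} {a y : V} (h : D.Reachable a y) :
    ∃ n, Escapes D n y a := by
  induction h with
  | refl => exact ⟨0, rfl⟩
  | tail _ hbc ih =>
    obtain ⟨n, hn⟩ := ih
    exact ⟨n + 1, _, hbc, hn⟩

/-- If every vertex of a non-empty set closed under taking ancestors can be reached from a vertex
that it cannot reach, then the set contains a back-ray. -/
theorem exists_backRay {D : MultiDigraph V E} {X : Set V} (hX : IsInClosed D X) {x : V}
    (hx : x ∈ X) (hesc : ∀ y ∈ X, ∃ a, D.Reachable a y ∧ ¬ D.Reachable y a) :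
    ∃ R ⊆ X, D.IsBackRay R := by
  classical
  have hex : ∀ y ∈ X, ∃ n a, Escapes D n y a ∧ ¬ D.Reachable y a := by
    intro y hy
    obtain ⟨a, hay, hya⟩ := hesc y hy
    obtain ⟨n, hn⟩ := exists_escapes hay
    exact ⟨n, a, hn, hya⟩
  -- On `X`, `d y` is the distance back to the nearest ancestor that `y` cannot reach. Stepping
  -- along a shortest such walk lowers `d` as long as the strong component is not left.
  set d : V → ℕ := fun y => sInf {n | ∃ a, Escapes D n y a ∧ ¬ D.Reachable y a} with hd
  have hstep : ∀ y ∈ X, ∃ z ∈ X, D.Adj z y ∧ (D.Reachable y z → d z < d y) := by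
    intro y hy
    obtain ⟨a, hya, hna⟩ := Nat.sInf_mem (s := {n | ∃ a, Escapes D n y a ∧ ¬ D.Reachable y a})
      (hex y hy)
    change Escapes D (d y) y a at hya
    rcases hdy : d y with _ | n
    · rw [hdy] at hya
      exact absurd (show D.Reachable y a from hya ▸ Relation.ReflTransGen.refl) hna
    · rw [hdy] at hya
      obtain ⟨z, hzy, hza⟩ := hya
      refine ⟨z, hX.mem_of_reachable (Relation.ReflTransGen.single hzy) hy, hzy, fun hyz => ?_⟩
      refine Nat.lt_succ_of_le (Nat.sInf_le ⟨a, hza, fun h => hna (hyz.trans h)⟩)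
  choose! f hfX hfadj hfd using hstep
  set r : ℕ → V := fun n => f^[n] x with hr
  have hrs : ∀ n, r (n + 1) = f (r n) := fun n => Function.iterate_succ_apply' f n x
  have hrX : ∀ n, r n ∈ X := by
    intro n
    induction n with
    | zero => exact hx
    | succ n ih => rw [hrs]; exact hfX _ ih
  have hradj : ∀ n, D.Adj (r (n + 1)) (r n) := fun n => by rw [hrs]; exact hfadj _ (hrX n)
  have hreach : ∀ m n, m ≤ n → D.Reachable (r n) (r m) := by
    intro m n hmn
    induction n, hmn using Nat.le_induction with
    | base => exact Relation.ReflTransGen.refl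
    | succ n _ ih => exact Relation.ReflTransGen.head (hradj n) ih
  -- A repeated vertex would close a walk within one strong component, around which `d` strictly
  -- decreases.
  have hne : ∀ m n, m < n → r m ≠ r n := by
    intro m n hmn heq
    have hlt : ∀ j, m ≤ j → j < n → d (r (j + 1)) < d (r j) := by
      intro j hmj hjn
      rw [hrs]
      refine hfd _ (hrX j) ?_
      rw [← hrs]
      have h1 := hreach m j hmj
      rw [heq] at h1
      exact h1.trans (hreach (j + 1) n hjn)
    have hlt' : ∀ j, m < j → j ≤ n → d (r j) < d (r m) := by
      intro j hmj
      induction j, hmj using Nat.le_induction with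
      | base => exact fun h => hlt m le_rfl h
      | succ j hj ih => exact fun h => (hlt j (by omega) h).trans (ih (by omega))
    have := hlt' n hmn le_rfl
    rw [heq] at this
    exact lt_irrefl _ this
  refine ⟨Set.range r, ?_, r, fun m n hmn => ?_, hradj, rfl⟩
  · rintro _ ⟨n, rfl⟩
    exact hrX n
  · by_contra hcon
    rcases lt_or_gt_of_ne hcon with h | h
    · exact hne m n h hmn
    · exact hne n m h hmn.symm

/-- Either some vertex of `X` reaches all its ancestors, and then its strong component is a source
component, or `exists_backRay` applies. -/
theorem IsInClosed.exists_source {D : MultiDigraph V E} {X : Set V} (hX : IsInClosed D X)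
    (hne : X.Nonempty) : ∃ C ⊆ X, D.IsSourceComponent C ∨ D.IsBackRay C := by
  obtain ⟨x, hx⟩ := hne
  by_cases hesc : ∀ y ∈ X, ∃ a, D.Reachable a y ∧ ¬ D.Reachable y a
  · obtain ⟨R, hR, hray⟩ := exists_backRay hX hx hesc
    exact ⟨R, hR, Or.inr hray⟩
  · push Not at hesc
    obtain ⟨y, hy, hall⟩ := hesc
    refine ⟨{z | D.Reachable y z ∧ D.Reachable z y}, fun z hz => hX.mem_of_reachable hz.2 hy,
      Or.inl ⟨⟨y, rfl⟩, fun e he => ?_⟩⟩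
    have h1 : D.Reachable (D.tail e) y := Relation.ReflTransGen.head ⟨e, rfl, rfl⟩ he.2
    exact ⟨hall _ h1, h1⟩

/-- The out-shores of the sink-sided dicuts. -/
def sinkFamily (D : MultiDigraph V E) : Set (Set V) :=
  {X | X.Nonempty ∧ IsInClosed D X ∧ ∀ C, D.IsSinkComponent C ∨ D.IsOutRay C → ¬ C ⊆ X}

/-- The edges with their tail in `X` and their head outside `X`. -/
def boundary (D : MultiDigraph V E) (X : Set V) : Set E :=
  {e | D.tail e ∈ X ∧ D.head e ∉ X}

theorem isOutShore_iff {D : MultiDigraph V E} {X : Set V} {B : Set E} :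
    D.IsOutShore X B ↔ X.Nonempty ∧ Xᶜ.Nonempty ∧ IsInClosed D X ∧ B = boundary D X := by
  unfold MultiDigraph.IsOutShore MultiDigraph.edgesBetween IsInClosed boundary
  refine and_congr_right fun _ => and_congr_right fun _ => ⟨?_, ?_⟩
  · rintro ⟨rfl, hB⟩
    have hcl : ∀ e, D.head e ∈ X → D.tail e ∈ X := by
      intro e he
      by_contra hte
      exact hB e (Or.inl ⟨⟨he, fun h => h he⟩, hte, hte⟩) he
    refine ⟨hcl, Set.ext fun e => ⟨?_, fun he => Or.inr ⟨⟨he.2, he.2⟩, he.1, fun h => h he.1⟩⟩⟩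
    rintro (he | he)
    · exact absurd (hcl e he.1.1) he.2.2
    · exact ⟨he.2.1, he.1.2⟩
  · rintro ⟨hcl, rfl⟩
    refine ⟨Set.ext fun e => ⟨fun he => Or.inr ⟨⟨he.2, he.2⟩, he.1, fun h => h he.1⟩, ?_⟩,
      fun e he => he.2⟩
    rintro (he | he)
    · exact absurd (hcl e he.1.1) he.2.2
    · exact ⟨he.2.1, he.1.2⟩

theorem boundary_compl (D : MultiDigraph V E) (X : Set V) :
    boundary D Xᶜ = boundary (reversed D) X := by
  ext e
  simp [boundary, reversed, and_comm]

theorem isInClosed_compl {D : MultiDigraph V E} {X : Set V} :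
    IsInClosed D Xᶜ ↔ IsInClosed (reversed D) X := by
  simp only [IsInClosed, reversed, Set.mem_compl_iff]
  exact forall_congr' fun e => not_imp_not

theorem sinkFamily_subset {D : MultiDigraph V E} {X Y : Set V} (hX : X ∈ sinkFamily D)
    (hY : IsInClosed D Y) (hYX : Y ⊆ X) (hne : Y.Nonempty) : Y ∈ sinkFamily D :=
  ⟨hne, hY, fun C hC hCY => hX.2.2 C hC (hCY.trans hYX)⟩

theorem exists_sink (D : MultiDigraph V E) {X : Set V} (hX : IsInClosed (reversed D) X)
    (hne : X.Nonempty) : ∃ C ⊆ X, D.IsSinkComponent C ∨ D.IsOutRay C := by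
  obtain ⟨C, hC, h⟩ := hX.exists_source hne
  exact ⟨C, hC, h.imp reversed_isSourceComponent.1 reversed_isBackRay.1⟩

theorem mem_sinkFamily_reversed {D : MultiDigraph V E} {Y : Set V} :
    Y ∈ sinkFamily (reversed D) ↔ Y.Nonempty ∧ IsInClosed (reversed D) Y ∧
      ∀ C, D.IsSourceComponent C ∨ D.IsBackRay C → ¬ C ⊆ Y := by
  unfold sinkFamily
  rw [Set.mem_ofPred_eq]
  have h1 : ∀ C, (reversed D).IsSinkComponent C ↔ D.IsSourceComponent C := fun C =>
    (reversed_isSourceComponent (D := reversed D)).symm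
  have h2 : ∀ C, (reversed D).IsOutRay C ↔ D.IsBackRay C := fun C =>
    (reversed_isBackRay (D := reversed D)).symm
  simp only [h1, h2]

/-- The complement of `X` is automatically non-empty, since the whole digraph contains a sink
component or an out-ray. -/
theorem isSinkSided_iff {D : MultiDigraph V E} {B : Set E} :
    D.IsSinkSided B ↔ ∃ X ∈ sinkFamily D, B = boundary D X := by
  simp only [MultiDigraph.IsSinkSided, isOutShore_iff]
  refine exists_congr fun X => ⟨fun ⟨⟨h1, _, h2, h3⟩, h4⟩ => ⟨⟨h1, h2, h4⟩, h3⟩,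
    fun ⟨⟨h1, h2, h4⟩, h3⟩ => ⟨⟨h1, ?_, h2, h3⟩, h4⟩⟩
  by_contra hemp
  rw [Set.not_nonempty_iff_eq_empty, Set.compl_empty_iff] at hemp
  subst hemp
  obtain ⟨C, hC, hsink⟩ := exists_sink D (X := Set.univ) (fun _ _ => trivial) h1
  exact h4 C hsink hC

theorem isSourceSided_iff {D : MultiDigraph V E} {B : Set E} :
    D.IsSourceSided B ↔ ∃ Y ∈ sinkFamily (reversed D), B = boundary (reversed D) Y := by
  simp only [MultiDigraph.IsSourceSided, isOutShore_iff, mem_sinkFamily_reversed]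
  constructor
  · rintro ⟨X, ⟨h1, h2, h3, h4⟩, h5⟩
    refine ⟨Xᶜ, ⟨h2, ?_, h5⟩, ?_⟩
    · rwa [← isInClosed_compl, compl_compl]
    · rw [← boundary_compl, compl_compl, h4]
  · rintro ⟨Y, ⟨h1, h2, h3⟩, h4⟩
    refine ⟨Yᶜ, ⟨?_, by rwa [compl_compl], isInClosed_compl.2 h2, by rw [boundary_compl, h4]⟩,
      by rwa [compl_compl]⟩
    by_contra hemp
    rw [Set.not_nonempty_iff_eq_empty, Set.compl_empty_iff] at hemp
    subst hemp
    obtain ⟨C, hC, hsource⟩ := IsInClosed.exists_source (D := D) (X := Set.univ)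
      (fun _ _ => trivial) h1
    exact h3 C hsource hC

theorem isSourceSinkDicut_iff {D : MultiDigraph V E} {B : Set E} :
    D.IsSourceSinkDicut B ↔ (∃ Y ∈ sinkFamily (reversed D), B = boundary (reversed D) Y) ∨
      ∃ X ∈ sinkFamily D, B = boundary D X := by
  rw [← isSourceSided_iff, ← isSinkSided_iff]
  refine ⟨fun h => h.2, fun h => ⟨?_, h⟩⟩
  rcases h with ⟨X, h, -⟩ | ⟨X, h, -⟩
  · exact ⟨X, h⟩
  · exact ⟨X, h⟩

/-- In a source-sink connected digraph every dicut is a source-sink dicut. -/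
theorem isSourceSinkDicut_iff_isDicut {D : MultiDigraph V E} (hD : D.SourceSinkConnected)
    {B : Set E} : D.IsSourceSinkDicut B ↔ D.IsDicut B := by
  refine ⟨fun h => h.1, fun h => ⟨h, ?_⟩⟩
  obtain ⟨X, hX⟩ := h
  by_contra! hcon
  simp only [MultiDigraph.IsSinkSided, MultiDigraph.IsSourceSided, not_exists, not_and] at hcon
  have h1 := hcon.1 X hX
  have h2 := hcon.2 X hX
  push Not at h1 h2
  obtain ⟨C₁, hC₁, hC₁X⟩ := h1
  obtain ⟨C₂, hC₂, hC₂X⟩ := h2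
  obtain ⟨x, hx, y, hy, hxy⟩ := hD C₁ C₂ hC₁ hC₂
  exact hC₁X hx ((isOutShore_iff.1 hX).2.2.1.mem_of_reachable hxy (hC₂X hy))

/-- For unions: an in-closed set contains every strong component that it meets, and every out-ray
that meets it infinitely often. An out-ray in `X ∪ Y` thus lies in `X` or has a tail in `Y`, and
then lies in `Y`. -/
theorem isIntersecting_sinkFamily (D : MultiDigraph V E) : IsIntersecting (sinkFamily D) := by
  refine ⟨fun X hX => hX.1, fun X hX Y hY => ⟨hX.1.mono Set.subset_union_left,
    fun e he => he.imp (hX.2.1 e) (hY.2.1 e), fun C hC hCXY => ?_⟩,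
    fun X hX Y hY hne => sinkFamily_subset hX (fun e he => ⟨hX.2.1 e he.1, hY.2.1 e he.2⟩)
      Set.inter_subset_left hne⟩
  rcases hC with hC | hC
  · obtain ⟨⟨x, rfl⟩, -⟩ := id hC
    rcases hCXY (show x ∈ _ from ⟨Relation.ReflTransGen.refl, Relation.ReflTransGen.refl⟩)
      with hx | hx
    · exact hX.2.2 _ (Or.inl hC) fun y hy => hX.2.1.mem_of_reachable hy.2 hx
    · exact hY.2.2 _ (Or.inl hC) fun y hy => hY.2.1.mem_of_reachable hy.2 hx
  · obtain ⟨r, -, hadj, rfl⟩ := id hC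
    have hreach : ∀ m n, m ≤ n → D.Reachable (r m) (r n) := by
      intro m n hmn
      induction n, hmn using Nat.le_induction with
      | base => exact Relation.ReflTransGen.refl
      | succ n _ ih => exact Relation.ReflTransGen.tail ih (hadj n)
    by_cases hall : ∀ m, ∃ n, m ≤ n ∧ r n ∈ X
    · refine hX.2.2 _ (Or.inr hC) ?_
      rintro _ ⟨m, rfl⟩
      obtain ⟨n, hmn, hn⟩ := hall m
      exact hX.2.1.mem_of_reachable (hreach m n hmn) hn
    · push Not at hall
      obtain ⟨m, hm⟩ := hall
      refine hY.2.2 _ (Or.inr hC) ?_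
      rintro _ ⟨n, rfl⟩
      have h1 := hm (max m n) (le_max_left _ _)
      exact hY.2.1.mem_of_reachable (hreach n _ (le_max_right m n))
        ((hCXY ⟨_, rfl⟩).resolve_left h1)

/-- The point is that `X \ Y` is non-empty: `X` contains a source component or a back-ray, and `Y`
contains neither. -/
theorem sinkFamily_diff {D : MultiDigraph V E} {X Y : Set V} (hX : X ∈ sinkFamily D)
    (hY : Y ∈ sinkFamily (reversed D)) : X \ Y ∈ sinkFamily D := by
  refine sinkFamily_subset hX (fun e he => ⟨hX.2.1 e he.1, fun h => he.2 (hY.2.1 e h)⟩)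
    Set.sdiff_subset ?_
  obtain ⟨C, hCX, hC⟩ := hX.2.1.exists_source hX.1
  obtain ⟨v, hvC, hvY⟩ := Set.not_subset.1 ((mem_sinkFamily_reversed.1 hY).2.2 C hC)
  exact ⟨v, hCX hvC, hvY⟩

end Digraph

/-! ### From finitely many dicuts to all of them -/

section Compactness

open Finset

variable {V E E' : Type*}

/-- The sets that do not separate any two points that belong to the same members of `𝒲`. -/
def saturated (𝒲 : Set (Set V)) : Set (Set V) :=
  {X | ∀ u v, (∀ Z ∈ 𝒲, u ∈ Z ↔ v ∈ Z) → u ∈ X → v ∈ X}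

/-- A saturated set is a union of atoms of `𝒲`, of which there are finitely many. This keeps the
closure of `𝒲` under uncrossing finite. -/
theorem finite_saturated {𝒲 : Set (Set V)} (hfin : 𝒲.Finite) : (saturated 𝒲).Finite := by
  set π : V → Set (Set V) := fun v => {Z ∈ 𝒲 | v ∈ Z} with hπ
  refine ((hfin.finite_subsets.finite_subsets).image fun U => π ⁻¹' U).subset fun X hX =>
    ⟨π '' X, ?_, ?_⟩
  · rintro _ ⟨v, _, rfl⟩ Z hZ
    exact hZ.1
  · refine Set.Subset.antisymm ?_ (Set.subset_preimage_image π X)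
    rintro v ⟨u, hu, huv⟩
    refine hX u v (fun Z hZ => ?_) hu
    have := Set.ext_iff.1 huv Z
    simpa [hπ, hZ] using this

theorem mem_iff_of_saturated {𝒲 : Set (Set V)} {X : Set V} (hX : X ∈ saturated 𝒲) {u v : V}
    (huv : ∀ Z ∈ 𝒲, u ∈ Z ↔ v ∈ Z) : u ∈ X ↔ v ∈ X :=
  ⟨hX u v huv, hX v u fun Z hZ => (huv Z hZ).symm⟩

theorem subset_saturated (𝒲 : Set (Set V)) : 𝒲 ⊆ saturated 𝒲 :=
  fun X hX _ _ huv hu => (huv X hX).1 hu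

theorem saturated_union {𝒲 : Set (Set V)} {X Y : Set V} (hX : X ∈ saturated 𝒲)
    (hY : Y ∈ saturated 𝒲) : X ∪ Y ∈ saturated 𝒲 :=
  fun u v huv hu => hu.imp (hX u v huv) (hY u v huv)

theorem saturated_inter {𝒲 : Set (Set V)} {X Y : Set V} (hX : X ∈ saturated 𝒲)
    (hY : Y ∈ saturated 𝒲) : X ∩ Y ∈ saturated 𝒲 :=
  fun u v huv hu => ⟨hX u v huv hu.1, hY u v huv hu.2⟩

theorem saturated_diff {𝒲 : Set (Set V)} {X Y : Set V} (hX : X ∈ saturated 𝒲)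
    (hY : Y ∈ saturated 𝒲) : X \ Y ∈ saturated 𝒲 :=
  fun u v huv hu => ⟨hX u v huv hu.1, fun hv => hu.2 ((mem_iff_of_saturated hY huv).2 hv)⟩

theorem boundary_union_subset (D : MultiDigraph V E) (X Y : Set V) :
    boundary D (X ∪ Y) ⊆ boundary D X ∪ boundary D Y := by
  rintro e ⟨h1, h2⟩
  exact h1.imp (fun h => ⟨h, fun h' => h2 (Or.inl h')⟩) fun h => ⟨h, fun h' => h2 (Or.inr h')⟩

theorem boundary_inter_subset (D : MultiDigraph V E) (X Y : Set V) :
    boundary D (X ∩ Y) ⊆ boundary D X ∪ boundary D Y := by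
  rintro e ⟨h1, h2⟩
  by_cases h : D.head e ∈ X
  · exact Or.inr ⟨h1.2, fun h' => h2 ⟨h, h'⟩⟩
  · exact Or.inl ⟨h1.1, h⟩

theorem boundary_diff_subset (D : MultiDigraph V E) (X Y : Set V) :
    boundary D (X \ Y) ⊆ boundary D X ∪ boundary (reversed D) Y := by
  rintro e ⟨h1, h2⟩
  by_cases h : D.head e ∈ X
  · exact Or.inr ⟨by_contra fun h' => h2 ⟨h, h'⟩, h1.2⟩
  · exact Or.inl ⟨h1.1, h⟩

/-- An ideal of sets of edges of `D`, such that every source-sink dicut in it is represented by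
finitely many, but at least `k`, elements of `E'`. -/
structure IsCapacityModel (D : MultiDigraph V E) (π : E' → E) (𝓘 : Set (Set E)) (k : ℕ) : Prop where
  ideal : ∀ A ∈ 𝓘, ∀ B ∈ 𝓘, ∀ C ⊆ A ∪ B, C ∈ 𝓘
  finite : ∀ A ∈ 𝓘, (π ⁻¹' A).Finite
  le_ncard : ∀ B, D.IsSourceSinkDicut B → B ∈ 𝓘 → k ≤ (π ⁻¹' B).ncard

/-- The saturated out-shores with boundary in a given ideal. -/
def saturatedFamily (D : MultiDigraph V E) (𝓘 : Set (Set E)) (𝒲 : Set (Set V)) : Set (Set V) :=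
  {X ∈ sinkFamily D | X ∈ saturated 𝒲 ∧ boundary D X ∈ 𝓘}

theorem IsCapacityModel.isIntersecting {D : MultiDigraph V E} {π : E' → E} {𝓘 : Set (Set E)} {k : ℕ}
    (H : IsCapacityModel D π 𝓘 k) (D' : MultiDigraph V E) (𝒲 : Set (Set V)) :
    IsIntersecting (saturatedFamily D' 𝓘 𝒲) :=
  ⟨fun _ hX => hX.1.1,
    fun X hX Y hY => ⟨(isIntersecting_sinkFamily D').union X hX.1 Y hY.1,
      saturated_union hX.2.1 hY.2.1,
      H.ideal _ hX.2.2 _ hY.2.2 _ (boundary_union_subset D' X Y)⟩,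
    fun X hX Y hY hne => ⟨(isIntersecting_sinkFamily D').inter X hX.1 Y hY.1 hne,
      saturated_inter hX.2.1 hY.2.1,
      H.ideal _ hX.2.2 _ hY.2.2 _ (boundary_inter_subset D' X Y)⟩⟩

theorem leaving_eq_boundary {D : MultiDigraph V E} {π : E' → E} {A : Finset E'} {X : Set V}
    (hA : π ⁻¹' boundary D X ⊆ A) :
    (leaving A (D.tail ∘ π) (D.head ∘ π) X : Set E') = π ⁻¹' boundary D X := by
  ext e
  rw [Finset.mem_coe, mem_leaving]
  exact ⟨fun he => he.2, fun he => ⟨hA he, he⟩⟩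

/-- The colouring theorem for finitely many dicuts. -/
theorem IsCapacityModel.exists_finite_colouring {D : MultiDigraph V E} {π : E' → E}
    {𝓘 : Set (Set E)} {k : ℕ} (H : IsCapacityModel D π 𝓘 k) {𝒲 : Set (Set V)} (h𝒲 : 𝒲.Finite) :
    ∃ c : E' → ℕ,
      (∀ X ∈ 𝒲, X ∈ sinkFamily D → boundary D X ∈ 𝓘 → ∀ i < k,
        ∃ e, π e ∈ boundary D X ∧ c e = i) ∧
      ∀ Y ∈ 𝒲, Y ∈ sinkFamily (reversed D) → boundary (reversed D) Y ∈ 𝓘 → ∀ i < k,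
        ∃ e, π e ∈ boundary (reversed D) Y ∧ c e = i := by
  set 𝒜 := saturatedFamily D 𝓘 𝒲 with h𝒜
  set ℬ := saturatedFamily (reversed D) 𝓘 𝒲 with hℬ
  have hfinA : 𝒜.Finite := (finite_saturated h𝒲).subset fun X hX => hX.2.1
  have hfinB : ℬ.Finite := (finite_saturated h𝒲).subset fun X hX => hX.2.1
  have hfin : ((⋃ X ∈ 𝒜, π ⁻¹' boundary D X) ∪ ⋃ Y ∈ ℬ, π ⁻¹' boundary (reversed D) Y).Finite :=
    (hfinA.biUnion fun X hX => H.finite _ hX.2.2).union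
      (hfinB.biUnion fun Y hY => H.finite _ hY.2.2)
  set A := hfin.toFinset with hA
  have hAl : ∀ X ∈ 𝒜, π ⁻¹' boundary D X ⊆ A := fun X hX e he => by
    rw [hA, Set.Finite.coe_toFinset]
    exact Or.inl (Set.mem_biUnion hX he)
  have hAr : ∀ Y ∈ ℬ, π ⁻¹' boundary (reversed D) Y ⊆ A := fun Y hY e he => by
    rw [hA, Set.Finite.coe_toFinset]
    exact Or.inr (Set.mem_biUnion hY he)
  have I : IsPackingInstance k 𝒜 ℬ A (D.tail ∘ π) (D.head ∘ π) := by
    refine ⟨hfinA, hfinB, H.isIntersecting D 𝒲, H.isIntersecting (reversed D) 𝒲, ?_, ?_, ?_, ?_,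
      ?_, ?_⟩
    · exact fun X hX Y hY => ⟨sinkFamily_diff hX.1 hY.1, saturated_diff hX.2.1 hY.2.1,
        H.ideal _ hX.2.2 _ hY.2.2 _ (boundary_diff_subset D X Y)⟩
    · exact fun X hX Y hY => ⟨sinkFamily_diff hY.1 hX.1, saturated_diff hY.2.1 hX.2.1,
        H.ideal _ hY.2.2 _ hX.2.2 _ (boundary_diff_subset (reversed D) Y X)⟩
    · exact fun e _ X hX => hX.1.2.1 (π e)
    · exact fun e _ Y hY => hY.1.2.1 (π e)
    · intro X hX
      rw [← Set.ncard_coe_finset, leaving_eq_boundary (hAl X hX)]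
      exact H.le_ncard _ (isSourceSinkDicut_iff.2 (Or.inr ⟨X, hX.1, rfl⟩)) hX.2.2
    · intro Y hY
      rw [← Set.ncard_coe_finset]
      change k ≤ (leaving A ((reversed D).tail ∘ π) ((reversed D).head ∘ π) Y : Set E').ncard
      rw [leaving_eq_boundary (hAr Y hY)]
      exact H.le_ncard _ (isSourceSinkDicut_iff.2 (Or.inl ⟨Y, hY.1, rfl⟩)) hY.2.2
  obtain ⟨c, hcA, hcB⟩ := I.packable
  refine ⟨c, fun X hX hXs hXI i hi => ?_, fun Y hY hYs hYI i hi => ?_⟩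
  · obtain ⟨e, he, hei⟩ := hcA X ⟨hXs, subset_saturated _ hX, hXI⟩ i hi
    exact ⟨e, (mem_leaving.1 he).2, hei⟩
  · obtain ⟨e, he, hei⟩ := hcB Y ⟨hYs, subset_saturated _ hY, hYI⟩ i hi
    exact ⟨e, (mem_leaving.1 he).2, hei⟩

/-- For every finite set of elements there is a colouring that is good for all dicuts that are
represented inside this set. -/
theorem IsCapacityModel.exists_local_colouring {D : MultiDigraph V E} {π : E' → E}
    {𝓘 : Set (Set E)} {k : ℕ} (H : IsCapacityModel D π 𝓘 k) (s : Finset E') :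
    ∃ c : E' → ℕ, ∀ B, D.IsSourceSinkDicut B → B ∈ 𝓘 → π ⁻¹' B ⊆ s → ∀ i < k,
      ∃ e, π e ∈ B ∧ c e = i := by
  -- Infinitely many shores may have their boundary represented inside `s`, but only finitely many
  -- subsets of `s` arise; one shore for each is enough.
  have hrep : ∀ D' : MultiDigraph V E, ∃ 𝒲 : Set (Set V), 𝒲.Finite ∧
      ∀ X ∈ sinkFamily D', boundary D' X ∈ 𝓘 → π ⁻¹' boundary D' X ⊆ s →
        ∃ Z ∈ 𝒲, Z ∈ sinkFamily D' ∧ boundary D' Z ∈ 𝓘 ∧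
          π ⁻¹' boundary D' Z = π ⁻¹' boundary D' X := by
    intro D'
    set 𝒳 : Set (Set V) :=
      {X ∈ sinkFamily D' | boundary D' X ∈ 𝓘 ∧ π ⁻¹' boundary D' X ⊆ s} with h𝒳
    have hfin : ((fun X => π ⁻¹' boundary D' X) '' 𝒳).Finite := by
      refine s.finite_toSet.finite_subsets.subset ?_
      rintro _ ⟨X, hX, rfl⟩
      exact hX.2.2
    obtain ⟨𝒲, h𝒲, hbij⟩ := Set.exists_subset_bijOn 𝒳 fun X => π ⁻¹' boundary D' X
    have heq := hbij.image_eq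
    refine ⟨𝒲, Set.Finite.of_finite_image (heq ▸ hfin) hbij.injOn, fun X hX hXI hXs => ?_⟩
    have : π ⁻¹' boundary D' X ∈ (fun X => π ⁻¹' boundary D' X) '' 𝒲 := by
      rw [heq]
      exact ⟨X, ⟨hX, hXI, hXs⟩, rfl⟩
    obtain ⟨Z, hZ, hZX⟩ := this
    exact ⟨Z, hZ, (h𝒲 hZ).1, (h𝒲 hZ).2.1, hZX⟩
  obtain ⟨𝒲₁, hfin₁, h₁⟩ := hrep D
  obtain ⟨𝒲₂, hfin₂, h₂⟩ := hrep (reversed D)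
  obtain ⟨c, hcA, hcB⟩ := H.exists_finite_colouring (hfin₁.union hfin₂)
  refine ⟨c, fun B hB hBI hBs i hi => ?_⟩
  rcases isSourceSinkDicut_iff.1 hB with ⟨Y, hY, rfl⟩ | ⟨X, hX, rfl⟩
  · obtain ⟨Z, hZ, hZs, hZI, hZY⟩ := h₂ Y hY hBI hBs
    obtain ⟨e, he, hei⟩ := hcB Z (Or.inr hZ) hZs hZI i hi
    exact ⟨e, (Set.ext_iff.1 hZY e).1 he, hei⟩
  · obtain ⟨Z, hZ, hZs, hZI, hZX⟩ := h₁ X hX hBI hBs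
    obtain ⟨e, he, hei⟩ := hcA Z (Or.inl hZ) hZs hZI i hi
    exact ⟨e, (Set.ext_iff.1 hZX e).1 he, hei⟩

/-- The colouring theorem for all source-sink dicuts in an ideal. -/
theorem IsCapacityModel.exists_colouring {D : MultiDigraph V E} {π : E' → E}
    {𝓘 : Set (Set E)} {k : ℕ} (H : IsCapacityModel D π 𝓘 k) :
    ∃ c : E' → ℕ, ∀ B, D.IsSourceSinkDicut B → B ∈ 𝓘 → ∀ i < k, ∃ e, π e ∈ B ∧ c e = i := by
  choose g hg using H.exists_local_colouring
  -- Rado's lemma needs finitely many colours, so all colours from `k` on are merged into `k`. Each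
  -- dicut is represented by a finite set, on which `χ` agrees with some local colouring.
  obtain ⟨χ, hχ⟩ := Finset.rado_selection (β := fun _ : E' => Fin (k + 1))
    fun s e => ⟨min (g s e) k, by omega⟩
  refine ⟨fun e => χ e, fun B hB hBI i hi => ?_⟩
  obtain ⟨t, hst, ht⟩ := hχ (H.finite B hBI).toFinset
  obtain ⟨e, he, hei⟩ := hg t B hB hBI (fun e he => hst ((Set.Finite.mem_toFinset _).2 he)) i hi
  refine ⟨e, he, ?_⟩
  simp only [ht e ((Set.Finite.mem_toFinset _).2 he), hei]
  omega

end Compactness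

/-! ### Weak duality, copies of edges and the min-max equalities -/

section Capacities

variable {V : Type u} {E : Type v}

open Cardinal

/-- Weak duality for disjoint dijoins. -/
theorem mk_le_of_disjoint_dijoins {𝔅 : Set (Set E)} {B : Set E} (hB : B ∈ 𝔅)
    {𝓕 : Set (Set E)} (h𝓕 : ∀ F ∈ 𝓕, IsDijoin 𝔅 F) (hdisj : 𝓕.PairwiseDisjoint id) :
    #𝓕 ≤ #B := by
  choose e he using fun F : 𝓕 => h𝓕 F F.2 B hB
  refine mk_le_of_injective (f := fun F : 𝓕 => (⟨e F, (he F).2⟩ : B)) fun F G hFG => ?_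
  have heq : e F = e G := congrArg Subtype.val hFG
  by_contra hne
  have := hdisj F.2 G.2 fun h => hne (Subtype.ext h)
  exact Set.disjoint_left.1 this (he F).1 (heq ▸ (he G).1)

/-- Weak duality for capacity-disjoint dijoins. -/
theorem mk_le_edgeCapacity {c : E → Cardinal.{w}} {𝔅 : Set (Set E)} {B : Set E} (hB : B ∈ 𝔅)
    {ι : Type (max v w)} {F : ι → Set E} (hF : ∀ i, IsDijoin 𝔅 (F i))
    (hdisj : CapacityDisjoint c F) : #ι ≤ edgeCapacity c B := by
  have hinj : ∀ e, ∃ f : {i // e ∈ F i} → (c e).out, Function.Injective f := by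
    intro e
    have h := hdisj e
    rw [← Cardinal.mk_out (c e), ← Cardinal.mk_uLift] at h
    obtain ⟨f⟩ := (Cardinal.le_def _ _).1 h
    exact ⟨fun i => (f i).down, ULift.down_injective.comp f.injective⟩
  choose f hf using hinj
  choose e he using fun i => hF i B hB
  -- Each dijoin is sent to an edge of `B` that it contains, together with one of the `c e` slots of
  -- this edge; distinct dijoins using the same edge get distinct slots.
  refine mk_le_of_injective
    (f := fun i => (⟨⟨e i, (he i).2⟩, f (e i) ⟨i, (he i).1⟩⟩ : Σ a : B, (c a).out)) fun i j hij => ?_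
  have key : ∀ (x y : E) (hx : x ∈ B) (hy : y ∈ B) (hix : i ∈ {i | x ∈ F i})
      (hjy : j ∈ {i | y ∈ F i}), (⟨⟨x, hx⟩, f x ⟨i, hix⟩⟩ : Σ a : B, (c a).out) =
        ⟨⟨y, hy⟩, f y ⟨j, hjy⟩⟩ → i = j := by
    intro x y hx hy hix hjy h
    obtain rfl : x = y := congrArg (fun s : Σ a : B, (c a).out => (s.1 : E)) h
    have := hf x (eq_of_heq (Sigma.mk.inj h).2)
    exact congrArg Subtype.val this
  exact key _ _ _ _ _ _ hij

theorem edgeCapacity_le_add {c : E → Cardinal.{w}} {A B C : Set E} (h : C ⊆ A ∪ B) :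
    edgeCapacity c C ≤ edgeCapacity c A + edgeCapacity c B := by
  classical
  change #(Σ a : C, (c a).out) ≤ #(Σ a : A, (c a).out) + #(Σ a : B, (c a).out)
  rw [Cardinal.add_def]
  refine mk_le_of_injective (f := fun x : Σ a : C, (c a).out =>
    if hx : (x.1 : E) ∈ A then (Sum.inl ⟨⟨x.1, hx⟩, x.2⟩ : (Σ a : A, (c a).out) ⊕ Σ a : B, (c a).out)
    else Sum.inr ⟨⟨x.1, (h x.1.2).resolve_left hx⟩, x.2⟩) ?_
  rintro ⟨⟨x, hxC⟩, p⟩ ⟨⟨y, hyC⟩, q⟩ hxy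
  by_cases hx : x ∈ A <;> by_cases hy : y ∈ A
  · simp only [hx, hy, dif_pos, Sum.inl.injEq] at hxy
    obtain rfl : x = y := congrArg (fun s : Σ a : A, (c a).out => (s.1 : E)) hxy
    simpa using hxy
  · simp [hx, hy] at hxy
  · simp [hx, hy] at hxy
  · simp only [hx, hy, dif_neg, not_false_iff, Sum.inr.injEq] at hxy
    obtain rfl : x = y := congrArg (fun s : Σ a : B, (c a).out => (s.1 : E)) hxy
    simpa using hxy

/-- The copies of the edges of a set of finite capacity. -/
theorem nonempty_equiv_copies {c : E → Cardinal.{w}} {A : Set E} (hA : edgeCapacity c A < ℵ₀) :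
    Nonempty ((Σ a : A, (c a).out) ≃
      ((Sigma.fst : (Σ e : E, Fin (toNat (c e))) → E) ⁻¹' A : Set (Σ e : E, Fin (toNat (c e))))) := by
  have hfin : Finite (Σ a : A, (c a).out) := Cardinal.lt_aleph0_iff_finite.1 hA
  have hequiv : ∀ a : A, Nonempty ((c a).out ≃ Fin (toNat (c a))) := by
    intro a
    have hfina : Finite (c a).out := Finite.of_injective
      (fun p => (⟨a, p⟩ : Σ a : A, (c a).out)) fun p q hpq => eq_of_heq (Sigma.mk.inj hpq).2
    have hcard : Nat.card (c a).out = toNat (c a) := by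
      rw [Nat.card, Cardinal.mk_out]
    exact ⟨hcard ▸ Finite.equivFin _⟩
  refine ⟨(Equiv.sigmaCongrRight fun a => (hequiv a).some).trans
    ⟨fun x => ⟨⟨x.1, x.2⟩, x.1.2⟩, fun x => ⟨⟨x.1.1, x.2⟩, x.1.2⟩, ?_, ?_⟩⟩
  · rintro ⟨⟨a, ha⟩, i⟩; rfl
  · rintro ⟨⟨a, i⟩, ha⟩; rfl

/-- Edges of infinite capacity get no copies, as `toNat` sends them to 0. This is harmless, because
no set of finite capacity contains such an edge. -/
theorem isCapacityModel_copies (D : MultiDigraph V E) (c : E → Cardinal.{w}) {k : ℕ}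
    (hk : ∀ B, D.IsSourceSinkDicut B → edgeCapacity c B < ℵ₀ → (k : Cardinal) ≤ edgeCapacity c B) :
    IsCapacityModel D (Sigma.fst : (Σ e : E, Fin (toNat (c e))) → E)
      {A | edgeCapacity c A < ℵ₀} k := by
  refine ⟨fun A hA B hB C hC => (edgeCapacity_le_add hC).trans_lt (add_lt_aleph0 hA hB),
    fun A hA => ?_, fun B hB hBfin => ?_⟩
  · obtain ⟨f⟩ := nonempty_equiv_copies hA
    have : Finite (Σ a : A, (c a).out) := Cardinal.lt_aleph0_iff_finite.1 hA
    have := Finite.of_equiv _ f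
    exact Set.toFinite _
  · obtain ⟨f⟩ := nonempty_equiv_copies hBfin
    have : Finite (Σ a : B, (c a).out) := Cardinal.lt_aleph0_iff_finite.1 hBfin
    rw [← Nat.card_coe_set_eq, ← Nat.card_congr f, ← Nat.cast_le (α := Cardinal),
      Nat.cast_card]
    exact hk B hB hBfin

theorem isCapacityModel_id (D : MultiDigraph V E) {k : ℕ}
    (hk : ∀ B, D.IsSourceSinkDicut B → B.Finite → (k : Cardinal) ≤ #B) :
    IsCapacityModel D id {A : Set E | A.Finite} k := by
  refine ⟨fun A hA B hB C hC => (hA.union hB).subset hC, fun A hA => hA, fun B hB hBfin => ?_⟩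
  have := hk B hB hBfin
  rw [Set.preimage_id]
  rwa [← Set.cast_ncard hBfin, Nat.cast_le] at this

theorem isWoodall_finite (D : MultiDigraph V E)
    (hne : {B : Set E | D.IsSourceSinkDicut B ∧ B.Finite}.Nonempty) :
    IsWoodall {B : Set E | D.IsSourceSinkDicut B ∧ B.Finite} := by
  set 𝔅 := {B : Set E | D.IsSourceSinkDicut B ∧ B.Finite} with h𝔅
  have hne' : {μ | ∃ B ∈ 𝔅, #B = μ}.Nonempty := let ⟨B, hB⟩ := hne; ⟨_, B, hB, rfl⟩
  obtain ⟨B₀, hB₀, hmin⟩ := csInf_mem hne'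
  have hle : ∀ B ∈ 𝔅, #B₀ ≤ #B := fun B hB => hmin ▸ csInf_le' ⟨B, hB, rfl⟩
  refine ⟨#B₀, ⟨⟨B₀, hB₀, rfl⟩, ?_⟩, ?_, ?_⟩
  · rintro _ ⟨B, hB, rfl⟩
    exact hle B hB
  · have hcard : (B₀.ncard : Cardinal) = #B₀ := Set.cast_ncard hB₀.2
    obtain ⟨c, hc⟩ := (isCapacityModel_id D (k := B₀.ncard) fun B hB hBfin =>
      hcard ▸ hle B ⟨hB, hBfin⟩).exists_colouring
    set F : Fin B₀.ncard → Set E := fun i => {e | c e = i} with hF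
    have hdij : ∀ i, IsDijoin 𝔅 (F i) := by
      intro i B hB
      obtain ⟨e, he, hei⟩ := hc B hB.1 hB.2 i i.2
      exact ⟨e, hei, he⟩
    have hdisj : ∀ i j e, e ∈ F i → e ∈ F j → i = j := fun i j e hi hj =>
      Fin.ext (hi.symm.trans hj)
    have hinj : Function.Injective F := by
      intro i j hij
      obtain ⟨e, he, -⟩ := hdij i B₀ hB₀
      exact hdisj i j e he (hij ▸ he)
    refine ⟨Set.range F, ?_, ?_, ?_⟩
    · rintro _ ⟨i, rfl⟩
      exact hdij i
    · rintro _ ⟨i, rfl⟩ _ ⟨j, rfl⟩ hij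
      refine Set.disjoint_left.2 fun e hi hj => hij ?_
      rw [hdisj i j e hi hj]
    · rw [← hcard]
      have := Cardinal.mk_range_eq_of_injective hinj
      simpa using this
  · rintro _ ⟨𝓕, h𝓕, hdisj, rfl⟩
    exact mk_le_of_disjoint_dijoins hB₀ h𝓕 hdisj

theorem isWoodallWith_finite (D : MultiDigraph V E) (c : E → Cardinal.{w})
    (hne : {B : Set E | D.IsSourceSinkDicut B ∧ edgeCapacity c B < ℵ₀}.Nonempty) :
    IsWoodallWith c {B : Set E | D.IsSourceSinkDicut B ∧ edgeCapacity c B < ℵ₀} := by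
  set 𝔅 := {B : Set E | D.IsSourceSinkDicut B ∧ edgeCapacity c B < ℵ₀} with h𝔅
  have hne' : {μ | ∃ B ∈ 𝔅, edgeCapacity c B = μ}.Nonempty :=
    let ⟨B, hB⟩ := hne; ⟨_, B, hB, rfl⟩
  obtain ⟨B₀, hB₀, hmin⟩ := csInf_mem hne'
  have hle : ∀ B ∈ 𝔅, edgeCapacity c B₀ ≤ edgeCapacity c B :=
    fun B hB => hmin ▸ csInf_le' ⟨B, hB, rfl⟩
  refine ⟨edgeCapacity c B₀, ⟨⟨B₀, hB₀, rfl⟩, ?_⟩, ?_, ?_⟩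
  · rintro _ ⟨B, hB, rfl⟩
    exact hle B hB
  · obtain ⟨k, hk⟩ := lt_aleph0.1 hB₀.2
    obtain ⟨χ, hχ⟩ := (isCapacityModel_copies D c (k := k) fun B hB hBfin =>
      hk ▸ hle B ⟨hB, hBfin⟩).exists_colouring
    refine ⟨ULift.{max v w} (Fin k), fun i => {e | ∃ j, χ ⟨e, j⟩ = i.down}, fun i B hB => ?_,
      fun e => ?_, by simp [hk]⟩
    · obtain ⟨⟨e, j⟩, he, hei⟩ := hχ B hB.1 hB.2 i.down i.down.2
      exact ⟨e, ⟨j, hei⟩, he⟩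
    · choose f hf using fun i : {i : ULift.{max v w} (Fin k) // ∃ j, χ ⟨e, j⟩ = i.down} => i.2
      have hinj : Function.Injective f := by
        intro i j hij
        have h1 := hf i
        rw [hij, hf j] at h1
        exact Subtype.ext (ULift.down_injective (Fin.ext h1.symm))
      have h1 := mk_le_of_injective
        (f := fun i => (ULift.up (f i) : ULift.{max v w} (Fin (toNat (c e)))))
        (ULift.up_injective.comp hinj)
      refine h1.trans ?_
      rw [mk_uLift, mk_fin, lift_natCast, ← lift_natCast.{v, w}, Cardinal.lift_le]
      exact natCast_toNat_le _
  · rintro _ ⟨ι, F, hF, hdisj, rfl⟩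
    exact mk_le_edgeCapacity hB₀ hF hdisj

end Capacities

end DijoinPacking

theorem mainTheorem6 {V : Type u} {E : Type v} (D : MultiDigraph V E) (hD : D.WeaklyConnected) :
    -- source-sink dicuts of finite size
    ({B : Set E | D.IsSourceSinkDicut B ∧ B.Finite}.Nonempty →
      IsWoodall {B : Set E | D.IsSourceSinkDicut B ∧ B.Finite}) ∧
    -- source-sink dicuts of finite capacity
    (∀ c : E → Cardinal.{w},
      {B : Set E | D.IsSourceSinkDicut B ∧ edgeCapacity c B < Cardinal.aleph0}.Nonempty →
      IsWoodallWith c {B : Set E | D.IsSourceSinkDicut B ∧ edgeCapacity c B < Cardinal.aleph0}) ∧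
    -- all dicuts of finite size, or of finite capacity, of a source-sink connected digraph
    (D.SourceSinkConnected →
      ({B : Set E | D.IsDicut B ∧ B.Finite}.Nonempty →
        IsWoodall {B : Set E | D.IsDicut B ∧ B.Finite}) ∧
      (∀ c : E → Cardinal.{w},
        {B : Set E | D.IsDicut B ∧ edgeCapacity c B < Cardinal.aleph0}.Nonempty →
        IsWoodallWith c {B : Set E | D.IsDicut B ∧ edgeCapacity c B < Cardinal.aleph0})) := by
  refine ⟨DijoinPacking.isWoodall_finite D, DijoinPacking.isWoodallWith_finite D, fun hss => ?_⟩
  simp only [← DijoinPacking.isSourceSinkDicut_iff_isDicut hss]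
  exact ⟨DijoinPacking.isWoodall_finite D, DijoinPacking.isWoodallWith_finite D⟩
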